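/- Let $X\subseteq\mathbb{C}^n$ and $Y\subseteq\mathbb{C}^m$ be affine varieties (Zariski closed subsets), with $X$ irreducible, and let $f\colon X\to Y$ be a polynomial map that is dominant, i.e. $f(X)$ is Zariski dense in $Y$. For an affine variety $V$, let $\mathrm{Sing}(V)$ denote the set of points of $V$ at which the local ring of $V$ is not regular. Then there is a Zariski open dense subset $U\subseteq Y$ such that for every $y\in U$, the fiber $f^{-1}(y)$, regarded as an affine variety in $\mathbb{C}^n$ (with its reduced structure), satisfies $$\mathrm{Sing}(f^{-1}(y))=f^{-1}(y)\cap \mathrm{Sing}(X).$$ In other words, such a fiber is smooth at each of its points outside $\mathrm{Sing}(X)$, and every singular point of $X$ that lies on such a fiber is a singular point of that fiber. -/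

import Mathlib

noncomputable section

namespace SingularFibers

open MvPolynomial

/-- The Zariski topology on the set `ℂⁿ`: the closed sets are the common zero sets of sets
(equivalently, ideals) of polynomials. It is not an instance, as `Fin n → ℂ` already carries the
Euclidean topology. -/
abbrev zariski (n : ℕ) : TopologicalSpace (Fin n → ℂ) :=
  TopologicalSpace.ofClosed {V | ∃ I : Ideal (MvPolynomial (Fin n) ℂ), V = zeroLocus ℂ I}
    ⟨⊤, by simp⟩
    (by
      intro A hA
      refine ⟨⨆ V : A, (hA V.2).choose, ?_⟩
      apply Set.Subset.antisymm
      · rw [le_zeroLocus_iff_le_vanishingIdeal]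
        refine iSup_le fun V => ?_
        rw [← le_zeroLocus_iff_le_vanishingIdeal, ← (hA V.2).choose_spec]
        exact Set.sInter_subset_of_mem V.2
      · refine Set.subset_sInter fun V hV => ?_
        rw [(hA hV).choose_spec]
        exact zeroLocus_anti_mono (le_iSup (fun V : A => (hA V.2).choose) ⟨V, hV⟩))
    (by
      rintro _ ⟨I, rfl⟩ _ ⟨J, rfl⟩
      refine ⟨I * J, ?_⟩
      ext x
      constructor
      · rintro (h | h)
        · exact zeroLocus_anti_mono Ideal.mul_le_left h
        · exact zeroLocus_anti_mono Ideal.mul_le_right h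
      · intro h
        by_contra hx
        simp only [Set.mem_union, mem_zeroLocus_iff, not_or, not_forall] at hx
        obtain ⟨⟨p, hp, hp0⟩, q, hq, hq0⟩ := hx
        have := h (p * q) (Ideal.mul_mem_mul hp hq)
        rw [map_mul] at this
        exact (mul_ne_zero hp0 hq0) this)

/-- An affine variety, embedded in `ℂⁿ`: a Zariski closed set (irreducibility is not included). -/
def IsAffineVariety {n : ℕ} (V : Set (Fin n → ℂ)) : Prop :=
  @IsClosed (Fin n → ℂ) (zariski n) V

/-- `V` is irreducible in the Zariski topology (in particular nonempty). -/
def IsZariskiIrreducible {n : ℕ} (V : Set (Fin n → ℂ)) : Prop :=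
  @IsIrreducible (Fin n → ℂ) (zariski n) V

/-- The restriction of `f` to `V` is given by polynomials. -/
def IsPolynomialMapOn {n m : ℕ} (f : (Fin n → ℂ) → (Fin m → ℂ)) (V : Set (Fin n → ℂ)) : Prop :=
  ∃ P : Fin m → MvPolynomial (Fin n) ℂ, ∀ x ∈ V, ∀ i, f x i = eval x (P i)

/-- The set `S` is Zariski dense in `V`. -/
def IsZariskiDenseIn {n : ℕ} (S V : Set (Fin n → ℂ)) : Prop :=
  S ⊆ V ∧ V ⊆ @closure (Fin n → ℂ) (zariski n) S

/-- The set `U` is a Zariski open subset of `V`. -/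
def IsZariskiOpenIn {n : ℕ} (U V : Set (Fin n → ℂ)) : Prop :=
  ∃ W : Set (Fin n → ℂ), @IsOpen (Fin n → ℂ) (zariski n) W ∧ U = V ∩ W

/-- The property `p` holds for a generic point of `V`: it holds at all points of some
Zariski open and dense subset of `V`. -/
def ForGeneric {n : ℕ} (V : Set (Fin n → ℂ)) (p : (Fin n → ℂ) → Prop) : Prop :=
  ∃ U : Set (Fin n → ℂ), IsZariskiOpenIn U V ∧ IsZariskiDenseIn U V ∧ ∀ y ∈ U, p y

/-- The ring of polynomial functions `ℂ[V] = ℂ[x₁, …, xₙ] / I(V)`. -/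
abbrev CoordinateRing {n : ℕ} (V : Set (Fin n → ℂ)) : Type :=
  MvPolynomial (Fin n) ℂ ⧸ vanishingIdeal ℂ V

/-- Evaluation of polynomial functions on `V` at a point of `V`. -/
def evalAt {n : ℕ} (V : Set (Fin n → ℂ)) (x : V) : CoordinateRing V →ₐ[ℂ] ℂ :=
  Ideal.Quotient.liftₐ (vanishingIdeal ℂ V) (aeval (x : Fin n → ℂ)) fun _ hp => hp x x.2

/-- The ideal of the polynomial functions on `V` that vanish at `x`. -/
def pointIdeal {n : ℕ} (V : Set (Fin n → ℂ)) (x : V) : Ideal (CoordinateRing V) :=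
  RingHom.ker (evalAt V x)

instance {n : ℕ} (V : Set (Fin n → ℂ)) (x : V) : (pointIdeal V x).IsPrime :=
  RingHom.ker_isPrime (evalAt V x)

/-- The local ring of `V` at its point `x`. -/
abbrev LocalRingAt {n : ℕ} (V : Set (Fin n → ℂ)) (x : V) : Type :=
  Localization.AtPrime (pointIdeal V x)

/-- The singular locus of an affine variety: the points whose local ring is not regular. -/
def Sing {n : ℕ} (V : Set (Fin n → ℂ)) : Set (Fin n → ℂ) :=
  {x | ∃ hx : x ∈ V, ¬ IsRegularLocalRing (LocalRingAt V ⟨x, hx⟩)}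

/-- The fiber over `y` of the restriction of `f` to `X`. -/
def fiber {n m : ℕ} (f : (Fin n → ℂ) → (Fin m → ℂ)) (X : Set (Fin n → ℂ)) (y : Fin m → ℂ) :
    Set (Fin n → ℂ) :=
  {x | x ∈ X ∧ f x = y}

end SingularFibers

end

/-! ### Regular local rings and parts of regular systems of parameters. -/

namespace SingularFibers

open IsLocalRing

/-! Let B be the coordinate ring of X. By Noether normalization the image of ℂ[y₁, …, yₘ] in B is
finite over a polynomial ring ℂ[t₁, …, t_d]. Hence a fiber of f coincides, near each of its points,
with a fiber of t : X → 𝔸ᵈ, and it is enough to study t. Let O be the local ring of X at x, with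
maximal ideal 𝔪, and put τᵢ = tᵢ - tᵢ(x). Three facts hold as soon as t(x) avoids a suitable
hypersurface g = 0 (`exists_forall_isRegularLocalRing_iff`).

Flatness. By generic flatness O is flat over the polynomial ring, so dim O/(τ) + d ≤ dim O. If O/(τ)
is regular, then adjoining the τᵢ to lifts of minimal generators of its maximal ideal shows that O
is regular. So singular points of X are singular on the fiber.

Submersivity, even at singular points of X (`exists_forall_cotangentIndependent`). The τᵢ are
independent in 𝔪/𝔪². This is Noetherian induction on closed subsets: an irreducible closed Z either
has non-dense image in 𝔸ᵈ, which g avoids, or the tᵢ are algebraically independent on Z. In the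
second case, by characteristic zero, the τᵢ are independent in the cotangent space of Z at a general
point of Z, hence also in that of X, which maps to it. Consequently, if O is regular, so is O/(τ).

Reducedness. Choose δ ≠ 0 in B such that X is regular where δ ≠ 0. There the scheme-theoretic fiber
of t is regular, so its local rings are domains. Generic flatness of B/δ makes δ a nonzerodivisor on
the fiber, so the whole fiber is reduced, also along Sing X. Therefore O/(τ) is the local ring of
the reduced fiber (`IsAffineVariety.nonempty_quotient_localShift_equiv`), and the first two facts
conclude. -/

/-- Elements of a local ring whose classes in the cotangent space are linearly independent
over the residue field. -/
def CotangentIndependent {R ι : Type*} [CommRing R] [IsLocalRing R] [Fintype ι]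
    (τ : ι → R) : Prop :=
  ∀ a : ι → R, ∑ i, a i * τ i ∈ maximalIdeal R ^ 2 → ∀ i, a i ∈ maximalIdeal R

theorem WithBot.natCast_le_of_natCast_add_le {a c : ℕ} {b : WithBot ℕ∞}
    (h : ((a + c : ℕ) : WithBot ℕ∞) ≤ b + c) : (a : WithBot ℕ∞) ≤ b := by
  induction b using WithBot.recBotCoe with
  | bot => simp at h
  | coe b =>
    induction b using ENat.recTopCoe with
    | top => exact WithBot.coe_le_coe.2 le_top
    | coe b =>
      have h' : a + c ≤ b + c := by exact_mod_cast h
      exact_mod_cast Nat.le_of_add_le_add_right h'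

theorem spanFinrank_range_le {R ι : Type*} [CommRing R] [Fintype ι] (τ : ι → R) :
    (Ideal.span (Set.range τ)).spanFinrank ≤ Fintype.card ι := by
  refine (Submodule.spanFinrank_span_le_ncard_of_finite (Set.finite_range τ)).trans ?_
  rw [← Set.image_univ]
  exact (Set.ncard_image_le Set.finite_univ).trans (by simp [Set.ncard_univ])

/-- A cotangent independent family extends to a minimal generating set of the maximal ideal. -/
theorem CotangentIndependent.exists_complement {R ι : Type*} [CommRing R] [IsLocalRing R]
    [IsNoetherianRing R] [Fintype ι] {τ : ι → R} (hτ : ∀ i, τ i ∈ maximalIdeal R)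
    (h : CotangentIndependent τ) :
    ∃ (k : ℕ) (σ : Fin k → R), k + Fintype.card ι = (maximalIdeal R).spanFinrank ∧
      Ideal.span (Set.range τ ∪ Set.range σ) = maximalIdeal R := by
  let V := CotangentSpace R
  let K := ResidueField R
  let v : ι → V := fun i => (maximalIdeal R).toCotangent ⟨τ i, hτ i⟩
  have hv : LinearIndependent K v := by
    rw [Fintype.linearIndependent_iff]
    intro g hg i
    choose a ha using fun i => IsLocalRing.residue_surjective (g i)
    have key : (maximalIdeal R).toCotangent (∑ i, a i • ⟨τ i, hτ i⟩) = 0 := by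
      rw [map_sum, ← hg]
      refine Finset.sum_congr rfl fun i _ => ?_
      rw [map_smul, ← ha i]
      exact (IsScalarTower.algebraMap_smul K (a i) (v i)).symm
    rw [Ideal.toCotangent_eq_zero] at key
    rw [← ha i]
    refine (residue_eq_zero_iff _).2 (h a ?_ i)
    simpa using key
  let W := V ⧸ Submodule.span K (Set.range v)
  have hfr : Module.finrank K W + Fintype.card ι = (maximalIdeal R).spanFinrank := by
    rw [spanFinrank_maximalIdeal_eq_finrank_cotangentSpace,
      ← Submodule.finrank_quotient_add_finrank (Submodule.span K (Set.range v)),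
      finrank_span_eq_card hv]
  let b := Module.finBasis K W
  choose w hw using fun j => Submodule.mkQ_surjective (Submodule.span K (Set.range v)) (b j)
  choose s hs using fun j => (maximalIdeal R).toCotangent_surjective (w j)
  refine ⟨_, fun j => (s j : R), hfr, ?_⟩
  let S : Set (maximalIdeal R) := Set.range (fun i => (⟨τ i, hτ i⟩ : maximalIdeal R)) ∪ Set.range s
  have hS : Submodule.span K ((maximalIdeal R).toCotangent '' S) = ⊤ := by
    have himg : (maximalIdeal R).toCotangent '' S = Set.range v ∪ Set.range w := by
      rw [Set.image_union, ← Set.range_comp, ← Set.range_comp]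
      congr 2
      exact funext hs
    rw [himg, Submodule.span_union]
    have : (Submodule.span K (Set.range w)).map (Submodule.span K (Set.range v)).mkQ = ⊤ := by
      rw [Submodule.map_span, ← Set.range_comp, ← b.span_eq]
      congr 2
      exact funext hw
    rw [eq_top_iff, ← Submodule.comap_top (Submodule.mkQ (Submodule.span K (Set.range v))),
      ← this, Submodule.comap_map_mkQ]
  rw [CotangentSpace.span_image_eq_top_iff] at hS
  have := congrArg (Submodule.map (maximalIdeal R).subtype) hS
  rw [Submodule.map_span, Submodule.map_top, Submodule.range_subtype] at this
  refine Eq.trans ?_ this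
  rw [Set.image_union, ← Set.range_comp, ← Set.range_comp]
  rfl

theorem maximalIdeal_quotient_eq_map {R : Type*} [CommRing R] [IsLocalRing R] (I : Ideal R)
    [IsLocalRing (R ⧸ I)] :
    (maximalIdeal R).map (Ideal.Quotient.mk I) = maximalIdeal (R ⧸ I) :=
  map_maximalIdeal_of_surjective _ Ideal.Quotient.mk_surjective

theorem span_range_le_maximalIdeal {R ι : Type*} [CommRing R] [IsLocalRing R]
    {τ : ι → R} (hτ : ∀ i, τ i ∈ maximalIdeal R) : Ideal.span (Set.range τ) ≤ maximalIdeal R :=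
  Ideal.span_le.2 (by rintro _ ⟨i, rfl⟩; exact hτ i)

theorem isLocalRing_quotient_span_range {R ι : Type*} [CommRing R] [IsLocalRing R]
    {τ : ι → R} (hτ : ∀ i, τ i ∈ maximalIdeal R) : IsLocalRing (R ⧸ Ideal.span (Set.range τ)) := by
  have : Nontrivial (R ⧸ Ideal.span (Set.range τ)) := Ideal.Quotient.nontrivial_iff.2 fun h =>
    (maximalIdeal.isMaximal R).ne_top (top_le_iff.1 (h ▸ span_range_le_maximalIdeal hτ))
  exact IsLocalRing.of_surjective' _ Ideal.Quotient.mk_surjective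

/-- Krull: passing to the quotient by `d` elements drops the dimension by at most `d`. -/
theorem ringKrullDim_le_quotient_span_range_add_card {R ι : Type*} [CommRing R] [IsLocalRing R]
    [IsNoetherianRing R] [Fintype ι] {τ : ι → R} (hτ : ∀ i, τ i ∈ maximalIdeal R) :
    ringKrullDim R ≤ ringKrullDim (R ⧸ Ideal.span (Set.range τ)) + Fintype.card ι := by
  refine (ringKrullDim_le_ringKrullDim_quotient_add_spanFinrank (Ideal.span (Set.range τ))
    ?_).trans ?_
  · rw [IsLocalRing.ringJacobson_eq_maximalIdeal]
    exact span_range_le_maximalIdeal hτ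
  · gcongr
    exact_mod_cast spanFinrank_range_le τ

/-- The elements complementing τ in a minimal generating set generate the maximal ideal of the
quotient. So the embedding dimension drops by at least d, while the Krull dimension drops by at most
d; comparing the two gives regularity of the quotient. -/
theorem CotangentIndependent.spanFinrank_quotient_add_card_le {R ι : Type*} [CommRing R]
    [IsLocalRing R] [IsNoetherianRing R] [Fintype ι] {τ : ι → R} (hτ : ∀ i, τ i ∈ maximalIdeal R)
    (h : CotangentIndependent τ) [IsLocalRing (R ⧸ Ideal.span (Set.range τ))] :
    (maximalIdeal (R ⧸ Ideal.span (Set.range τ))).spanFinrank + Fintype.card ι ≤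
      (maximalIdeal R).spanFinrank := by
  obtain ⟨k, σ, hk, hσ⟩ := h.exists_complement hτ
  rw [← hk, ← maximalIdeal_quotient_eq_map, ← hσ, Ideal.span_union, Ideal.map_sup,
    Ideal.map_quotient_self, bot_sup_eq, Ideal.map_span, ← Set.range_comp]
  gcongr
  simpa using spanFinrank_range_le (Ideal.Quotient.mk (Ideal.span (Set.range τ)) ∘ σ)

/-- The quotient of a regular local ring by part of a regular system of parameters is regular. -/
theorem IsRegularLocalRing.quotient_span_range {R ι : Type*} [CommRing R] [IsRegularLocalRing R]
    [Fintype ι] {τ : ι → R} (hτ : ∀ i, τ i ∈ maximalIdeal R) (h : CotangentIndependent τ) :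
    IsRegularLocalRing (R ⧸ Ideal.span (Set.range τ)) := by
  have := isLocalRing_quotient_span_range hτ
  refine IsRegularLocalRing.of_spanFinrank_maximalIdeal_le _ ?_
  have hle := h.spanFinrank_quotient_add_card_le hτ
  have hdim := ringKrullDim_le_quotient_span_range_add_card hτ
  rw [← IsRegularLocalRing.spanFinrank_maximalIdeal] at hdim
  exact WithBot.natCast_le_of_natCast_add_le ((Nat.cast_le.2 hle).trans hdim)

/-- If the quotient of a local ring `R` by `d` elements is regular, of dimension `dim R - d`,
then `R` is regular. -/
theorem IsRegularLocalRing.of_quotient_span_range {R ι : Type*} [CommRing R] [IsLocalRing R]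
    [IsNoetherianRing R] [Fintype ι] {τ : ι → R} (hτ : ∀ i, τ i ∈ maximalIdeal R)
    (hdim : ringKrullDim (R ⧸ Ideal.span (Set.range τ)) + Fintype.card ι ≤ ringKrullDim R)
    (hreg : IsRegularLocalRing (R ⧸ Ideal.span (Set.range τ))) : IsRegularLocalRing R := by
  refine IsRegularLocalRing.of_spanFinrank_maximalIdeal_le _ (le_trans ?_ hdim)
  set I := Ideal.span (Set.range τ) with hI
  rw [← IsRegularLocalRing.spanFinrank_maximalIdeal]
  have hfg := (maximalIdeal (R ⧸ I)).fg_of_isNoetherianRing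
  obtain ⟨s, hscard, hs⟩ := Submodule.FG.exists_span_finset_card_eq_spanFinrank hfg
  choose l hl using Ideal.Quotient.mk_surjective (I := I)
  have hspan : maximalIdeal R = Ideal.span (Set.range τ ∪ l '' s) := by
    have h1 : (Ideal.span (l '' (s : Set (R ⧸ I)))).map (Ideal.Quotient.mk I) =
        maximalIdeal (R ⧸ I) := by
      rw [Ideal.map_span, ← Set.image_comp]
      have : (Ideal.Quotient.mk I) ∘ l = id := funext hl
      rw [this, Set.image_id]
      exact hs
    rw [← maximalIdeal_quotient_eq_map] at h1
    have h2 := congrArg (Ideal.comap (Ideal.Quotient.mk I)) h1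
    rw [Ideal.comap_map_of_surjective _ Ideal.Quotient.mk_surjective,
      Ideal.comap_map_of_surjective _ Ideal.Quotient.mk_surjective, ← RingHom.ker_eq_comap_bot,
      Ideal.mk_ker, sup_eq_left.2 (span_range_le_maximalIdeal hτ)] at h2
    rw [← h2, Ideal.span_union, sup_comm]
  have hfin : (Set.range τ ∪ l '' (s : Set (R ⧸ I))).Finite :=
    (Set.finite_range τ).union (s.finite_toSet.image l)
  have : (maximalIdeal R).spanFinrank ≤ (maximalIdeal (R ⧸ I)).spanFinrank + Fintype.card ι := by
    calc (maximalIdeal R).spanFinrank ≤ (Set.range τ ∪ l '' (s : Set (R ⧸ I))).ncard := by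
          conv_lhs => rw [hspan]
          exact Submodule.spanFinrank_span_le_ncard_of_finite hfin
      _ ≤ (Set.range τ).ncard + (l '' (s : Set (R ⧸ I))).ncard := Set.ncard_union_le _ _
      _ ≤ Fintype.card ι + s.card := by
          gcongr
          · rw [← Set.image_univ]
            exact (Set.ncard_image_le Set.finite_univ).trans (by simp [Set.ncard_univ])
          · exact (Set.ncard_image_le s.finite_toSet).trans (by simp)
      _ = _ := by rw [hscard, add_comm]
  exact_mod_cast this

/-- Induction on the dimension. Take x in 𝔪 outside 𝔪² and outside all minimal primes. Then R/(x) is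
regular of smaller dimension, so (x) is prime and contains a minimal prime p. Since x ∉ p, every
element of p is x times an element of p; thus p ⊆ 𝔪p, and Nakayama gives p = 0. -/
theorem IsRegularLocalRing.isDomain_of_ringKrullDim_eq (n : ℕ) :
    ∀ (R : Type*) [CommRing R] [IsRegularLocalRing R], ringKrullDim R = n → IsDomain R := by
  induction n with
  | zero =>
    intro R _ _ h
    have h0 := IsRegularLocalRing.spanFinrank_maximalIdeal (R := R)
    rw [h] at h0
    have hbot : maximalIdeal R = ⊥ := (Submodule.spanFinrank_eq_zero_iff_eq_bot
      (maximalIdeal R).fg_of_isNoetherianRing).1 (by exact_mod_cast h0)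
    have : IsField R := IsLocalRing.isField_iff_maximalIdeal_eq.2 hbot
    exact this.isDomain
  | succ n ih =>
    intro R _ _ h
    have hsq := IsLocalRing.maximalIdeal_sq_lt_of_ringKrullDim_ne_zero (R := R)
      (by rw [h]; exact_mod_cast Nat.succ_ne_zero n)
    have hnot : ∀ p ∈ minimalPrimes R, ¬ maximalIdeal R ≤ p := by
      intro p hp hle
      have hpp : p.IsPrime := hp.1.1
      have heq : p = maximalIdeal R := le_antisymm (le_maximalIdeal hpp.ne_top) hle
      have h1 := maximalIdeal_height_eq_ringKrullDim (R := R)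
      rw [h, ← heq, Ideal.height_eq_zero_iff.2 hp] at h1
      have : (0 : ℕ) = n + 1 := by exact_mod_cast h1
      omega
    obtain ⟨x, hxm, hxsq, hxp⟩ : ∃ x ∈ maximalIdeal R, x ∉ maximalIdeal R ^ 2 ∧
        ∀ p ∈ minimalPrimes R, x ∉ p := by
      have hfin : (minimalPrimes R).Finite := minimalPrimes.finite_of_isNoetherianRing R
      -- Prime avoidance tolerates up to two non-prime ideals; 𝔪² fills both exceptional places.
      let s : Finset (Ideal R) := insert (maximalIdeal R ^ 2) hfin.toFinset
      have hnsub : ¬ (maximalIdeal R : Set R) ⊆ ⋃ i ∈ (s : Set (Ideal R)), i := by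
        rw [Ideal.subset_union_prime (f := fun J : Ideal R => J) (maximalIdeal R ^ 2)
          (maximalIdeal R ^ 2) (fun i hi hne _ => ?_)]
        · rintro ⟨i, hi, hle⟩
          rcases Finset.mem_insert.1 hi with rfl | hi
          · exact hsq.not_ge hle
          · exact hnot i (by simpa using hi) hle
        · exact ((by simpa using (Finset.mem_insert.1 hi).resolve_left hne :
            i ∈ minimalPrimes R)).1.1
      simp only [Set.not_subset, Set.mem_iUnion, not_exists] at hnsub
      obtain ⟨x, hx, h⟩ := hnsub
      exact ⟨x, hx, h _ (by simp [s]), fun p hp => h p (by simp [s, hp])⟩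
    let τ : Unit → R := fun _ => x
    have hτ : ∀ i, τ i ∈ maximalIdeal R := fun _ => hxm
    have hind : CotangentIndependent τ := by
      intro a ha i
      by_contra hu
      have hu : IsUnit (a i) := by simpa using hu
      refine hxsq ?_
      simpa [τ, Ideal.unit_mul_mem_iff_mem _ hu] using ha
    have hreg := IsRegularLocalRing.quotient_span_range hτ hind
    have hspan : Ideal.span (Set.range τ) = Ideal.span {x} := by simp [τ]
    have hdim : ringKrullDim (R ⧸ Ideal.span (Set.range τ)) = n := by
      have h1 := hind.spanFinrank_quotient_add_card_le hτ
      have h2 := ringKrullDim_le_quotient_span_range_add_card hτ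
      have h3 := IsRegularLocalRing.spanFinrank_maximalIdeal (R := R)
      rw [h] at h2 h3
      rw [← IsRegularLocalRing.spanFinrank_maximalIdeal] at h2 ⊢
      norm_cast at h2 h3 ⊢
      simp only [Fintype.card_unit] at h1 h2
      omega
    have hdom := ih _ hdim
    rw [hspan, Ideal.Quotient.isDomain_iff_prime] at hdom
    obtain ⟨p, hp, hple⟩ := Ideal.exists_minimalPrimes_le (I := ⊥) (J := Ideal.span {x}) bot_le
    have hpp : p.IsPrime := hp.1.1
    have hpbot : p = ⊥ := by
      refine Submodule.eq_bot_of_le_smul_of_le_jacobson_bot (maximalIdeal R) p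
        p.fg_of_isNoetherianRing ?_ (maximalIdeal_le_jacobson _)
      intro y hy
      obtain ⟨z, rfl⟩ := Ideal.mem_span_singleton.1 (hple hy)
      exact Submodule.smul_mem_smul hxm ((hpp.mem_or_mem hy).resolve_left (hxp p hp))
    rw [hpbot] at hpp
    exact IsDomain.of_bot_isPrime R

/-- A regular local ring is a domain. -/
theorem IsRegularLocalRing.isDomain (R : Type*) [CommRing R] [IsRegularLocalRing R] :
    IsDomain R :=
  IsRegularLocalRing.isDomain_of_ringKrullDim_eq _ R
    IsRegularLocalRing.spanFinrank_maximalIdeal.symm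

end SingularFibers

/-! ### Generic flatness, through the equational criterion. -/

namespace SingularFibers

/-- A linear relation `∑ aᵢ xᵢ = 0` that follows from linear relations between its
coefficients. -/
def TrivialRelation {A M ι : Type*} [CommRing A] [AddCommGroup M] [Module A M] [Fintype ι]
    (a : ι → A) (x : ι → M) : Prop :=
  ∃ (κ : Type) (_ : Fintype κ) (b : ι → κ → A) (y : κ → M),
    (∀ i, x i = ∑ j, b i j • y j) ∧ ∀ j, ∑ i, a i * b i j = 0

/-- Flatness of the localization `M[1/g]` over `A`, in terms of the equational criterion. -/
def FlatAway {A : Type*} [CommRing A] (g : A) (M : Type*) [AddCommGroup M] [Module A M] : Prop :=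
  ∀ (l : ℕ) (a : Fin l → A) (x : Fin l → M), ∑ i, a i • x i = 0 →
    ∃ k : ℕ, TrivialRelation a fun i => g ^ k • x i

section

variable {A : Type*} [CommRing A]

theorem TrivialRelation.map {M N ι : Type*} [AddCommGroup M] [Module A M] [AddCommGroup N]
    [Module A N] [Fintype ι] {a : ι → A} {x : ι → M} (h : TrivialRelation a x) (φ : M →ₗ[A] N) :
    TrivialRelation a fun i => φ (x i) := by
  obtain ⟨κ, _, b, y, hx, ha⟩ := h
  exact ⟨κ, inferInstance, b, fun j => φ (y j), fun i => by simp [hx i], ha⟩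

theorem TrivialRelation.add {M ι : Type*} [AddCommGroup M] [Module A M] [Fintype ι] {a : ι → A}
    {x x' : ι → M} (h : TrivialRelation a x) (h' : TrivialRelation a x') :
    TrivialRelation a fun i => x i + x' i := by
  obtain ⟨κ, _, b, y, hx, ha⟩ := h
  obtain ⟨κ', _, b', y', hx', ha'⟩ := h'
  refine ⟨κ ⊕ κ', inferInstance, fun i => Sum.elim (b i) (b' i), Sum.elim y y', fun i => ?_, ?_⟩
  · simp [hx i, hx' i]
  · rintro (j | j)
    · exact ha j
    · exact ha' j

theorem TrivialRelation.smul {M ι : Type*} [AddCommGroup M] [Module A M] [Fintype ι] {a : ι → A}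
    {x : ι → M} (h : TrivialRelation a x) (c : A) : TrivialRelation a fun i => c • x i :=
  h.map (c • LinearMap.id)

theorem TrivialRelation.sum_eq_zero {M ι : Type*} [AddCommGroup M] [Module A M] [Fintype ι]
    {a : ι → A} {x : ι → M} (h : TrivialRelation a x) : ∑ i, a i • x i = 0 := by
  obtain ⟨κ, _, b, y, hx, ha⟩ := h
  simp_rw [hx, Finset.smul_sum, smul_smul]
  rw [Finset.sum_comm]
  simp_rw [← Finset.sum_smul, ha, zero_smul, Finset.sum_const_zero]

variable {M M' M'' : Type*} [AddCommGroup M] [Module A M] [AddCommGroup M'] [Module A M']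
  [AddCommGroup M''] [Module A M''] {g h : A}

theorem FlatAway.mul_right (hM : FlatAway g M) (h : A) : FlatAway (g * h) M := by
  intro l a x hx
  obtain ⟨k, hk⟩ := hM l a x hx
  refine ⟨k, ?_⟩
  convert hk.smul (h ^ k) using 2 with i
  rw [smul_smul, mul_pow, mul_comm]

theorem FlatAway.of_dvd (hM : FlatAway g M) (hgh : g ∣ h) : FlatAway h M := by
  obtain ⟨c, rfl⟩ := hgh
  exact hM.mul_right c

theorem FlatAway.of_linearEquiv (hM : FlatAway g M) (e : M ≃ₗ[A] M') : FlatAway g M' := by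
  intro l a x hx
  obtain ⟨k, hk⟩ := hM l a (fun i => e.symm (x i)) (by
    simpa using congrArg e.symm hx)
  refine ⟨k, ?_⟩
  simpa using hk.map e.toLinearMap

/-- Trivialize the relation in M'' after multiplying by a power of g, and lift the trivialization to
M. The error lies in M' and satisfies the same relation, so it is trivialized there after a further
power of g. -/
theorem FlatAway.of_exact {i : M' →ₗ[A] M} {p : M →ₗ[A] M''} (hi : Function.Injective i)
    (hp : Function.Surjective p) (hex : Function.Exact i p) (h' : FlatAway g M')
    (h'' : FlatAway g M'') : FlatAway g M := by
  intro l a x hx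
  obtain ⟨k, κ, _, b, y, hy, ha⟩ := h'' l a (fun j => p (x j)) (by simpa using congrArg p hx)
  choose z hz using fun j => hp (y j)
  have hmem : ∀ j, ∃ w, i w = g ^ k • x j - ∑ t, b j t • z t := by
    intro j
    refine (hex _).1 ?_
    simp [hz, ← hy j]
  choose w hw using hmem
  have hzrel : TrivialRelation a fun j => ∑ t, b j t • z t := ⟨κ, inferInstance, b, z, fun _ => rfl, ha⟩
  obtain ⟨k', hk'⟩ := h' l a w (by
    apply hi
    rw [map_zero, map_sum]
    simp_rw [map_smul, hw, smul_sub, Finset.sum_sub_distrib, hzrel.sum_eq_zero, sub_zero,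
      smul_comm (a _) (g ^ k), ← Finset.smul_sum, hx, smul_zero])
  refine ⟨k' + k, ?_⟩
  convert (hk'.map i).add (hzrel.smul (g ^ k')) using 2 with j
  rw [map_smul, hw, smul_sub, smul_smul, pow_add, sub_add_cancel]

theorem FlatAway.of_iUnion {N : ℕ → Submodule A M} (hmono : Monotone N)
    (hN : ∀ x, ∃ n, x ∈ N n) (h : ∀ n, FlatAway g (N n)) : FlatAway g M := by
  intro l a x hx
  choose n hn using fun i => hN (x i)
  obtain ⟨m, hm⟩ : ∃ m, ∀ i, n i ≤ m := ⟨Finset.univ.sup n, fun i => Finset.le_sup (Finset.mem_univ i)⟩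
  obtain ⟨k, hk⟩ := h m l a (fun i => ⟨x i, hmono (hm i) (hn i)⟩) (by
    ext; simpa using hx)
  exact ⟨k, hk.map (N m).subtype⟩

theorem FlatAway.of_smul_eq_zero (hg : ∀ x : M, g • x = 0) : FlatAway g M := by
  intro l a x hx
  refine ⟨1, PEmpty, inferInstance, fun _ => PEmpty.elim, PEmpty.elim, fun i => by simp [hg],
    fun j => j.elim⟩

theorem FlatAway.self (g : A) : FlatAway g A := by
  intro l a x hx
  exact ⟨0, Unit, inferInstance, fun i _ => x i, fun _ => 1, fun i => by simp,
    fun _ => by simpa using hx⟩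

end

/-- Every finite `S`-module is generically flat over `A`. -/
def GenericallyFlat.{u, v, w} (A : Type u) (S : Type v) [CommRing A] [CommRing S] [Algebra A S] :
    Prop :=
  ∀ (M : Type w) [AddCommGroup M] [Module A M] [Module S M] [IsScalarTower A S M]
    [Module.Finite S M], ∃ g : A, g ≠ 0 ∧ FlatAway g M

universe w

/-- Dévissage: a finite module has a filtration with quotients A/p. For p = 0 the quotient is free;
for p ≠ 0 it is killed by a nonzero g in p. -/
theorem genericallyFlat_self (A : Type*) [CommRing A] [IsDomain A] [IsNoetherianRing A] :
    GenericallyFlat.{_, _, w} A A := by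
  intro M _ inst inst' htower hfin
  -- M carries two A-module structures, one from the base and one from S = A; the scalar tower
  -- forces them to agree.
  have hinst : inst = inst' := by
    refine Module.ext' _ _ fun r m => ?_
    have := @smul_assoc M A A _ inst'.toSMul inst.toSMul htower r 1 m
    rw [smul_eq_mul, mul_one, @one_smul A M _ inst'.toMulAction m] at this
    exact this.symm
  subst hinst
  induction hfin using IsNoetherianRing.induction_on_isQuotientEquivQuotientPrime A with
  | subsingleton N => exact ⟨1, one_ne_zero, .of_smul_eq_zero fun x => Subsingleton.elim _ _⟩
  | quotient N p e =>
    by_cases hp : p.1 = ⊥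
    · refine ⟨1, one_ne_zero, ((FlatAway.self 1).of_linearEquiv ?_).of_linearEquiv e.symm⟩
      exact ((Submodule.quotEquivOfEq _ _ hp).trans (Submodule.quotEquivOfEqBot ⊥ rfl)).symm
    · obtain ⟨g, hg, hg0⟩ := Submodule.exists_mem_ne_zero_of_ne_bot hp
      refine ⟨g, hg0, FlatAway.of_linearEquiv (.of_smul_eq_zero fun x => ?_) e.symm⟩
      obtain ⟨x, rfl⟩ := Ideal.Quotient.mk_surjective x
      rw [← Ideal.Quotient.mk_eq_mk, ← Submodule.Quotient.mk_smul]
      exact (Submodule.Quotient.mk_eq_zero _).2 (p.1.mul_mem_right x hg)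
  | exact N₁ N₂ N₃ i p hi hp hex h₁ h₃ =>
    obtain ⟨g₁, hg₁, h₁⟩ := h₁
    obtain ⟨g₃, hg₃, h₃⟩ := h₃
    exact ⟨g₁ * g₃, mul_ne_zero hg₁ hg₃,
      .of_exact hi hp hex (h₁.of_dvd (dvd_mul_right _ _)) (h₃.of_dvd (dvd_mul_left _ _))⟩

section Filtration

variable {S M : Type*} [CommRing S] [AddCommGroup M] [Module S M]

/-- The submodule `N + φ N + ⋯ + φⁿ N`. -/
def powFiltration (φ : Module.End S M) (N : Submodule S M) : ℕ → Submodule S M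
  | 0 => N
  | n + 1 => powFiltration φ N n ⊔ N.map (φ ^ (n + 1))

variable (φ : Module.End S M) (N : Submodule S M)

theorem powFiltration_mono : Monotone (powFiltration φ N) :=
  monotone_nat_of_le_succ fun _ => le_sup_left

theorem map_powFiltration_le (n : ℕ) :
    (powFiltration φ N n).map φ ≤ powFiltration φ N (n + 1) := by
  induction n with
  | zero => exact le_sup_of_le_right (by simp [powFiltration])
  | succ n ih =>
    rw [powFiltration, Submodule.map_sup]
    refine sup_le (ih.trans (powFiltration_mono φ N (Nat.le_succ _))) (le_sup_of_le_right ?_)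
    rw [← Submodule.map_comp, pow_succ' φ (n + 1)]
    exact le_rfl

/-- The elements of `N` whose image under `φⁿ⁺¹` lies in `N + φ N + ⋯ + φⁿ N`. -/
def powKernel (n : ℕ) : Submodule S N :=
  ((powFiltration φ N n).comap (φ ^ (n + 1))).submoduleOf N

theorem powKernel_mono : Monotone (powKernel φ N) := by
  refine monotone_nat_of_le_succ fun n x hx => ?_
  simp only [powKernel, Submodule.submoduleOf, Submodule.mem_comap] at hx ⊢
  rw [pow_succ' φ (n + 1)]
  exact map_powFiltration_le φ N n (Submodule.mem_map_of_mem hx)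

/-- The successive quotients of the filtration are quotients of `N`. -/
noncomputable def powFiltrationQuotientEquiv (n : ℕ) :
    (N ⧸ powKernel φ N n) ≃ₗ[S]
      (powFiltration φ N (n + 1) ⧸
        (powFiltration φ N n).submoduleOf (powFiltration φ N (n + 1))) := by
  have hmem : ∀ x : N, (φ ^ (n + 1)) x ∈ powFiltration φ N (n + 1) := fun x =>
    Submodule.mem_sup_right (Submodule.mem_map_of_mem x.2)
  let ψ : N →ₗ[S] powFiltration φ N (n + 1) :=
    LinearMap.codRestrict _ ((φ ^ (n + 1)) ∘ₗ N.subtype) hmem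
  let q := ((powFiltration φ N n).submoduleOf (powFiltration φ N (n + 1))).mkQ ∘ₗ ψ
  have hker : powKernel φ N n = LinearMap.ker q := by
    ext x
    rw [LinearMap.mem_ker, LinearMap.comp_apply, Submodule.mkQ_apply,
      Submodule.Quotient.mk_eq_zero]
    exact Iff.rfl
  refine (Submodule.quotEquivOfEq _ _ hker).trans (q.quotKerEquivOfSurjective ?_)
  intro y
  obtain ⟨⟨y, hy⟩, rfl⟩ := Submodule.mkQ_surjective _ y
  obtain ⟨u, hu, v, ⟨x, hx, rfl⟩, rfl⟩ := Submodule.mem_sup.1 hy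
  refine ⟨⟨x, hx⟩, ?_⟩
  refine (Submodule.Quotient.eq _).2 ?_
  change (φ ^ (n + 1)) x - (u + (φ ^ (n + 1)) x) ∈ powFiltration φ N n
  simpa using hu

end Filtration

/-- The successive quotients are N modulo an ascending chain of submodules. As N is Noetherian the
chain stabilizes, so only finitely many quotients occur up to isomorphism, and one product of
denominators serves all of them. -/
theorem GenericallyFlat.of_powFiltration {A S : Type*} [CommRing A] [IsDomain A] [CommRing S]
    [IsNoetherianRing S] [Algebra A S] (hS : GenericallyFlat.{_, _, w} A S) {M : Type w}
    [AddCommGroup M] [Module A M] [Module S M] [IsScalarTower A S M] (φ : Module.End S M)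
    {N : Submodule S M} (hN : N.FG) (hM : ∀ x, ∃ n, x ∈ powFiltration φ N n) :
    ∃ g : A, g ≠ 0 ∧ FlatAway g M := by
  have : Module.Finite S N := Module.Finite.iff_fg.2 hN
  obtain ⟨g₀, hg₀, h₀⟩ := hS N
  choose g hg h using fun n => hS (N ⧸ powKernel φ N n)
  obtain ⟨k, hk⟩ := monotone_stabilizes_iff_noetherian.2 (inferInstance : IsNoetherian S N)
    ⟨powKernel φ N, powKernel_mono φ N⟩
  let c := g₀ * ∏ i ∈ Finset.range (k + 1), g i
  have hquot : ∀ n, FlatAway c (N ⧸ powKernel φ N n) := by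
    intro n
    have key : ∀ j ≤ k, FlatAway c (N ⧸ powKernel φ N j) := fun j hj =>
      (h j).of_dvd (dvd_mul_of_dvd_right
        (Finset.dvd_prod_of_mem g (Finset.mem_range.2 (Nat.lt_succ_of_le hj))) _)
    rcases le_total n k with hn | hn
    · exact key n hn
    · exact (key k le_rfl).of_linearEquiv
        ((Submodule.quotEquivOfEq _ _ (hk n hn)).restrictScalars A)
  refine ⟨c, mul_ne_zero hg₀ (Finset.prod_ne_zero_iff.2 fun i _ => hg i),
    FlatAway.of_iUnion (N := fun n => (powFiltration φ N n).restrictScalars A)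
      (fun _ _ hab => powFiltration_mono φ N hab) hM fun n => ?_⟩
  induction n with
  | zero => exact h₀.of_dvd (dvd_mul_right _ _)
  | succ n ih =>
    let P := (powFiltration φ N n).submoduleOf (powFiltration φ N (n + 1))
    refine FlatAway.of_exact (M := powFiltration φ N (n + 1)) (i := P.subtype.restrictScalars A)
      (p := P.mkQ.restrictScalars A) P.subtype_injective P.mkQ_surjective
      (LinearMap.exact_subtype_mkQ P) ?_ ?_
    · exact ih.of_linearEquiv ((Submodule.submoduleOfEquivOfLe
        (powFiltration_mono φ N (Nat.le_succ n))).symm.restrictScalars A)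
    · exact (hquot n).of_linearEquiv ((powFiltrationQuotientEquiv φ N n).restrictScalars A)

/-- Let N be the S-span of finitely many S[X]-generators of M; then M is the union of the submodules
N + XN + ⋯ + XⁿN. -/
theorem GenericallyFlat.polynomial {A S : Type*} [CommRing A] [IsDomain A] [CommRing S]
    [IsNoetherianRing S] [Algebra A S] (hS : GenericallyFlat.{_, _, w} A S) :
    GenericallyFlat.{_, _, w} A (Polynomial S) := by
  intro M _ _ _ _ hfin
  let : Module S M := Module.compHom M (Polynomial.C : S →+* Polynomial S)
  have : IsScalarTower S (Polynomial S) M := IsScalarTower.of_algebraMap_smul fun r x => rfl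
  have : IsScalarTower A S M := IsScalarTower.of_algebraMap_smul fun r x => by
    rw [← algebraMap_smul (Polynomial S) r x, ← algebraMap_smul (Polynomial S) (algebraMap A S r) x,
      ← IsScalarTower.algebraMap_apply]
  let φ : Module.End S M := (LinearMap.lsmul (Polynomial S) M Polynomial.X).restrictScalars S
  obtain ⟨s, hs⟩ := hfin.fg_top
  let N : Submodule S M := Submodule.span S s
  refine hS.of_powFiltration φ (N := N) ⟨s, rfl⟩ fun x => ?_
  have hx : x ∈ Submodule.span (Polynomial S) (s : Set M) := hs ▸ Submodule.mem_top
  induction hx using Submodule.span_induction with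
  | mem x hx => exact ⟨0, Submodule.subset_span hx⟩
  | zero => exact ⟨0, zero_mem _⟩
  | add x y _ _ hx hy =>
    obtain ⟨n, hn⟩ := hx
    obtain ⟨m, hm⟩ := hy
    exact ⟨max n m, add_mem (powFiltration_mono φ N (le_max_left _ _) hn)
      (powFiltration_mono φ N (le_max_right _ _) hm)⟩
  | smul p x _ hx =>
    induction p using Polynomial.induction_on' with
    | add p q hp hq =>
      obtain ⟨n, hn⟩ := hp
      obtain ⟨m, hm⟩ := hq
      rw [add_smul]
      exact ⟨max n m, add_mem (powFiltration_mono φ N (le_max_left _ _) hn)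
        (powFiltration_mono φ N (le_max_right _ _) hm)⟩
    | monomial k a =>
      induction k with
      | zero =>
        obtain ⟨n, hn⟩ := hx
        exact ⟨n, Submodule.smul_mem _ a hn⟩
      | succ k ih =>
        obtain ⟨n, hn⟩ := ih
        refine ⟨n + 1, ?_⟩
        have := map_powFiltration_le φ N n (Submodule.mem_map_of_mem hn)
        rw [← Polynomial.X_mul_monomial, mul_smul]
        exact this

theorem GenericallyFlat.of_surjective {A S T : Type*} [CommRing A] [CommRing S] [CommRing T]
    [Algebra A S] [Algebra A T] (hS : GenericallyFlat.{_, _, w} A S) (φ : S →ₐ[A] T)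
    (hφ : Function.Surjective φ) : GenericallyFlat.{_, _, w} A T := by
  intro M _ _ _ _ _
  let : Algebra S T := φ.toAlgebra
  let : Module S M := Module.compHom M (φ : S →+* T)
  have : IsScalarTower S T M := IsScalarTower.of_algebraMap_smul fun r x => rfl
  have : IsScalarTower A S M := IsScalarTower.of_algebraMap_smul fun r x => by
    rw [← algebraMap_smul T r x, ← algebraMap_smul T (algebraMap A S r) x,
      ← φ.commutes]
    rfl
  have : Module.Finite S T := Module.Finite.of_surjective (Algebra.linearMap S T) hφ
  have : Module.Finite S M := Module.Finite.trans T M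
  exact hS M

theorem genericallyFlat_mvPolynomial (A : Type*) [CommRing A] [IsDomain A] [IsNoetherianRing A]
    (n : ℕ) : GenericallyFlat.{_, _, w} A (MvPolynomial (Fin n) A) := by
  induction n with
  | zero =>
    exact (genericallyFlat_self A).of_surjective (Algebra.ofId _ _)
      (MvPolynomial.C_surjective (Fin 0))
  | succ n ih =>
    exact ih.polynomial.of_surjective
      ((MvPolynomial.finSuccEquiv A n).symm.toAlgHom) (AlgEquiv.surjective _)

/-- Generic flatness. -/
theorem genericallyFlat_of_finiteType (A S : Type*) [CommRing A] [IsDomain A] [IsNoetherianRing A]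
    [CommRing S] [Algebra A S] [Algebra.FiniteType A S] : GenericallyFlat.{_, _, w} A S := by
  obtain ⟨n, φ, hφ⟩ := Algebra.FiniteType.iff_quotient_mvPolynomial''.1 ‹_›
  exact (genericallyFlat_mvPolynomial A n).of_surjective φ hφ

/-- Clearing denominators turns a relation over the localization into one over B; the denominators
and the powers of g are units in R. -/
theorem FlatAway.flat_localization {A B R : Type*} [CommRing A] [CommRing B] [Algebra A B] {g : A}
    (h : FlatAway g B) (S : Submonoid B) (hg : algebraMap A B g ∈ S) [CommRing R] [Algebra B R]
    [IsLocalization S R] [Algebra A R] [IsScalarTower A B R] : Module.Flat A R := by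
  refine Module.Flat.of_forall_isTrivialRelation fun {l a x} hx => ?_
  obtain ⟨s, hs⟩ := IsLocalization.exist_integer_multiples_of_finite S x
  choose b hb using hs
  have h0 : algebraMap B R (∑ i, a i • b i) = 0 := by
    simp_rw [map_sum, Algebra.smul_def, map_mul, hb, ← IsScalarTower.algebraMap_apply,
      ← Algebra.smul_def, smul_comm (a _) (s : B), ← Finset.smul_sum, hx, smul_zero]
  obtain ⟨t, ht⟩ := (IsLocalization.map_eq_zero_iff S R _).1 h0
  obtain ⟨k, κ, _, c, y, hy, hac⟩ := h l a (fun i => t * b i) (by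
    simpa [Finset.mul_sum] using ht)
  have hu : IsUnit (algebraMap B R (algebraMap A B g ^ k * t * s)) :=
    IsLocalization.map_units R (⟨_, hg⟩ ^ k * t * s : S)
  let e := Fintype.equivFin κ
  refine ⟨Fintype.card κ, fun i j => c i (e.symm j),
    fun j => (↑hu.unit⁻¹ : R) * algebraMap B R (y (e.symm j)), fun i => ?_, fun j => hac _⟩
  have h1 : algebraMap B R (algebraMap A B g ^ k * t * s) * x i =
      ∑ j, c i j • algebraMap B R (y j) := by
    have h2 := congrArg (algebraMap B R) (hy i)
    simp only [Algebra.smul_def, map_mul, map_pow, map_sum, hb] at h2 ⊢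
    simp only [← IsScalarTower.algebraMap_apply] at h2 ⊢
    rw [← h2]
    ring
  rw [e.symm.sum_comp fun j => c i j • ((↑hu.unit⁻¹ : R) * algebraMap B R (y j))]
  simp_rw [← mul_smul_comm, ← Finset.mul_sum, ← h1, ← mul_assoc]
  simp

/-- Away from g, δ stays a nonzerodivisor modulo the ideal (τ), because Tor₁(A/(τ), B/δ) vanishes
there. Concretely, δu = ∑ bᵢτᵢ is a relation among the classes of the bᵢ in B/δ. Trivializing it
writes gᵏbᵢ as δeᵢ plus terms contributing nothing to the sum, and then δ cancels. -/
theorem FlatAway.exists_pow_mul_mem {A B : Type*} [CommRing A] [CommRing B] [Algebra A B] {g : A}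
    {δ : B} (hδ : δ ∈ nonZeroDivisors B) (h : FlatAway g (B ⧸ Ideal.span {δ})) {l : ℕ}
    (τ : Fin l → A) {u : B} (hu : δ * u ∈ Ideal.span (Set.range fun i => algebraMap A B (τ i))) :
    ∃ k, algebraMap A B g ^ k * u ∈ Ideal.span (Set.range fun i => algebraMap A B (τ i)) := by
  obtain ⟨b, hb⟩ := (Ideal.mem_span_range_iff_exists_fun).1 hu
  obtain ⟨k, κ, _, c, y, hy, hac⟩ := h l τ (fun i => Ideal.Quotient.mk _ (b i)) (by
    have := congrArg (Ideal.Quotient.mk (Ideal.span {δ})) hb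
    rw [Ideal.Quotient.eq_zero_iff_mem.2 (Ideal.mul_mem_right _ _
      (Ideal.mem_span_singleton_self δ))] at this
    rw [← this, map_sum]
    refine Finset.sum_congr rfl fun i _ => ?_
    rw [mul_comm, ← Algebra.smul_def]
    rfl)
  choose z hz using fun j => Ideal.Quotient.mk_surjective (y j)
  have hmem : ∀ i, ∃ e, algebraMap A B g ^ k * b i - ∑ j, c i j • z j = δ * e := by
    intro i
    refine Ideal.mem_span_singleton.1 (Ideal.Quotient.eq_zero_iff_mem.1 ?_)
    rw [map_sub, sub_eq_zero, map_sum]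
    have h1 : (Ideal.Quotient.mk (Ideal.span {δ})) (algebraMap A B g ^ k * b i) =
        g ^ k • Ideal.Quotient.mk (Ideal.span {δ}) (b i) := by
      rw [← map_pow, ← Algebra.smul_def]
      rfl
    refine h1.trans ((hy i).trans ?_)
    refine Finset.sum_congr rfl fun j _ => ?_
    rw [← hz j]
    rfl
  choose e he using hmem
  refine ⟨k, (Ideal.mem_span_range_iff_exists_fun).2 ⟨e, ?_⟩⟩
  refine mul_cancel_left_mem_nonZeroDivisors hδ |>.1 ?_
  have h0 : ∑ i, (∑ j, c i j • z j) * algebraMap A B (τ i) = 0 := by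
    simp_rw [Finset.sum_mul, Algebra.smul_def]
    rw [Finset.sum_comm]
    refine Finset.sum_eq_zero fun j _ => ?_
    have := congrArg (algebraMap A B) (hac j)
    simp only [map_sum, map_mul, map_zero] at this
    calc _ = z j * ∑ i, algebraMap A B (τ i) * algebraMap A B (c i j) := by
          rw [Finset.mul_sum]; exact Finset.sum_congr rfl fun i _ => by ring
      _ = 0 := by rw [this, mul_zero]
  calc δ * ∑ i, e i * algebraMap A B (τ i)
      = ∑ i, (δ * e i) * algebraMap A B (τ i) := by
        rw [Finset.mul_sum]; exact Finset.sum_congr rfl fun i _ => by ring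
    _ = algebraMap A B g ^ k * ∑ i, b i * algebraMap A B (τ i) -
          ∑ i, (∑ j, c i j • z j) * algebraMap A B (τ i) := by
        rw [Finset.mul_sum, ← Finset.sum_sub_distrib]
        exact Finset.sum_congr rfl fun i _ => by rw [← he i]; ring
    _ = δ * (algebraMap A B g ^ k * u) := by rw [h0, hb]; ring

end SingularFibers

/-! ### Rational points, the Nullstellensatz and the dimension formula. -/

namespace SingularFibers

open IsLocalRing

section Points

variable {k B : Type*} [Field k] [CommRing B] [Algebra k B]

/-- The maximal ideal of a `k`-rational point, given as a `k`-algebra homomorphism to `k`. -/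
def ptIdeal (ev : B →ₐ[k] k) : Ideal B := RingHom.ker ev

instance (ev : B →ₐ[k] k) : (ptIdeal ev).IsPrime := RingHom.ker_isPrime ev

theorem mem_ptIdeal {ev : B →ₐ[k] k} {b : B} : b ∈ ptIdeal ev ↔ ev b = 0 := RingHom.mem_ker

/-- The local ring at a rational point. -/
abbrev LocalRingPt (ev : B →ₐ[k] k) : Type _ := Localization.AtPrime (ptIdeal ev)

/-- The elements `tᵢ - tᵢ(x)` of the coordinate ring. -/
def shift {ι : Type*} (ev : B →ₐ[k] k) (t : ι → B) (i : ι) : B :=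
  t i - algebraMap k B (ev (t i))

/-- The elements `tᵢ - tᵢ(x)` of the local ring at the point `x`. -/
def localShift {ι : Type*} (ev : B →ₐ[k] k) (t : ι → B) (i : ι) : LocalRingPt ev :=
  algebraMap B (LocalRingPt ev) (shift ev t i)

theorem eval_sub_algebraMap (ev : B →ₐ[k] k) (b : B) : ev (b - algebraMap k B (ev b)) = 0 := by
  simp

theorem shift_mem {ι : Type*} (ev : B →ₐ[k] k) (t : ι → B) (i : ι) : shift ev t i ∈ ptIdeal ev :=
  mem_ptIdeal.2 (eval_sub_algebraMap ev (t i))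

theorem localShift_mem {ι : Type*} (ev : B →ₐ[k] k) (t : ι → B) (i : ι) :
    localShift ev t i ∈ maximalIdeal (LocalRingPt ev) :=
  (IsLocalization.AtPrime.to_map_mem_maximal_iff _ (ptIdeal ev) _).2 (shift_mem ev t i)

theorem map_span_shift {ι : Type*} (ev : B →ₐ[k] k) (t : ι → B) :
    (Ideal.span (Set.range (shift ev t))).map (algebraMap B (LocalRingPt ev)) =
      Ideal.span (Set.range (localShift ev t)) := by
  rw [Ideal.map_span, ← Set.range_comp]
  rfl

/-- The functions that are constant modulo an ideal. -/
def constantModulo (ev : B →ₐ[k] k) (I : Ideal B) : Subalgebra k B where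
  carrier := {b | b - algebraMap k B (ev b) ∈ I}
  mul_mem' {a b} ha hb := by
    have : a * b - algebraMap k B (ev (a * b)) = (a - algebraMap k B (ev a)) * b +
        algebraMap k B (ev a) * (b - algebraMap k B (ev b)) := by
      simp only [map_mul]; ring
    rw [Set.mem_ofPred_eq, this]
    exact add_mem (I.mul_mem_right _ ha) (I.mul_mem_left _ hb)
  add_mem' {a b} ha hb := by
    have : a + b - algebraMap k B (ev (a + b)) = (a - algebraMap k B (ev a)) +
        (b - algebraMap k B (ev b)) := by
      simp only [map_add]; ring
    rw [Set.mem_ofPred_eq, this]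
    exact add_mem ha hb
  algebraMap_mem' r := by simp

theorem mem_constantModulo {ev : B →ₐ[k] k} {I : Ideal B} {b : B} :
    b ∈ constantModulo ev I ↔ b - algebraMap k B (ev b) ∈ I := Iff.rfl

theorem ptIdeal_le_of_constantModulo_eq_top {ev : B →ₐ[k] k} {I : Ideal B}
    (h : constantModulo ev I = ⊤) : ptIdeal ev ≤ I := by
  intro b hb
  have := mem_constantModulo.1 (h ▸ Algebra.mem_top : b ∈ constantModulo ev I)
  rwa [mem_ptIdeal.1 hb, map_zero, sub_zero] at this

/-- Being constant modulo I cuts out a subalgebra, so it may be tested on generators. -/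
theorem ptIdeal_le_of_adjoin_eq_top {ev : B →ₐ[k] k} {I : Ideal B} {s : Set B}
    (hs : Algebra.adjoin k s = ⊤) (h : ∀ b ∈ s, b - algebraMap k B (ev b) ∈ I) :
    ptIdeal ev ≤ I :=
  ptIdeal_le_of_constantModulo_eq_top (top_le_iff.1 (hs ▸ Algebra.adjoin_le h))

theorem ptIdeal_mvPolynomial {ι : Type*} (ev : MvPolynomial ι k →ₐ[k] k) :
    ptIdeal ev = Ideal.span (Set.range (shift ev MvPolynomial.X)) := by
  refine le_antisymm (ptIdeal_le_of_adjoin_eq_top (MvPolynomial.adjoin_range_X) ?_)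
    (Ideal.span_le.2 ?_)
  · rintro _ ⟨i, rfl⟩
    exact Ideal.subset_span ⟨i, rfl⟩
  · rintro _ ⟨i, rfl⟩
    exact shift_mem ev _ i

/-- Weak Nullstellensatz. -/
theorem exists_ptIdeal_eq [IsAlgClosed k] [Algebra.FiniteType k B] (M : Ideal B)
    [hM : M.IsMaximal] : ∃ ev : B →ₐ[k] k, ptIdeal ev = M := by
  let := Ideal.Quotient.field M
  have : Module.Finite k (B ⧸ M) := finite_of_finite_type_of_isJacobsonRing k (B ⧸ M)
  have hbij := IsAlgClosed.algebraMap_bijective_of_isIntegral (k := k) (K := B ⧸ M)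
  let e : k ≃ₐ[k] (B ⧸ M) := AlgEquiv.ofBijective (Algebra.ofId k (B ⧸ M)) hbij
  refine ⟨(e.symm : (B ⧸ M) →ₐ[k] k).comp (Ideal.Quotient.mkₐ k M), ?_⟩
  ext b
  rw [mem_ptIdeal]
  simp [Ideal.Quotient.eq_zero_iff_mem]

/-- Nullstellensatz. -/
theorem mem_radical_of_forall_pt [IsAlgClosed k] [Algebra.FiniteType k B] {I : Ideal B} {b : B}
    (h : ∀ ev : B →ₐ[k] k, I ≤ ptIdeal ev → ev b = 0) : b ∈ I.radical := by
  have : IsJacobsonRing B := isJacobsonRing_of_finiteType (A := k)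
  rw [← (isJacobsonRing_iff.1 this I.radical (Ideal.radical_isRadical I)), Ideal.jacobson,
    Ideal.mem_sInf]
  rintro M ⟨hle, hM⟩
  obtain ⟨ev, rfl⟩ := exists_ptIdeal_eq (k := k) M
  exact mem_ptIdeal.2 (h ev (Ideal.le_radical.trans hle))

/-- A rational point of affine `n`-space has height `n`. -/
theorem card_le_height_ptIdeal [IsAlgClosed k] {ι : Type*} [Fintype ι]
    (ev : MvPolynomial ι k →ₐ[k] k) : (Fintype.card ι : ℕ∞) ≤ (ptIdeal ev).height := by
  have hdim : ringKrullDim (MvPolynomial ι k) = Fintype.card ι := by simp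
  have : FiniteRingKrullDim (MvPolynomial ι k) := by
    rw [finiteRingKrullDim_iff_ne_bot_and_top, hdim]
    exact ⟨WithBot.natCast_ne_bot _, fun h => by
      have : ((Fintype.card ι : ℕ∞) : WithBot ℕ∞) = ((⊤ : ℕ∞) : WithBot ℕ∞) := h
      exact ENat.natCast_ne_top _ (WithBot.coe_injective this)⟩
  obtain ⟨M, hM, hheight⟩ := Ideal.exists_isMaximal_height (R := MvPolynomial ι k)
  rw [hdim] at hheight
  obtain ⟨ev', rfl⟩ := exists_ptIdeal_eq (k := k) M
  -- Some maximal ideal has height n; translation by c is an automorphism taking it to the given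
  -- point.
  let c : ι → k := fun i => ev' (MvPolynomial.X i) - ev (MvPolynomial.X i)
  let e : MvPolynomial ι k ≃ₐ[k] MvPolynomial ι k := AlgEquiv.ofAlgHom
    (MvPolynomial.aeval fun i => MvPolynomial.X i + MvPolynomial.C (c i))
    (MvPolynomial.aeval fun i => MvPolynomial.X i - MvPolynomial.C (c i))
    (by ext i; simp [MvPolynomial.algHom_C]) (by ext i; simp [MvPolynomial.algHom_C])
  have hcomp : ev' = ev.comp (e : MvPolynomial ι k →ₐ[k] MvPolynomial ι k) := by
    ext i
    simp [e, c, MvPolynomial.algHom_C]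
  have hcomap : ptIdeal ev' = (ptIdeal ev).comap (e.toRingEquiv : _ ≃+* _) := by
    rw [hcomp]
    ext b
    rw [Ideal.mem_comap, mem_ptIdeal, mem_ptIdeal]
    rfl
  rw [hcomap, RingEquiv.height_comap] at hheight
  exact le_of_eq (WithBot.coe_injective hheight).symm

end Points

section Dimension

variable {k B : Type*} [Field k] [CommRing B] [Algebra k B]

/-- The dimension formula at the points of a generically flat morphism to affine space. -/
theorem ringKrullDim_add_card_le_of_flatAway [IsAlgClosed k] [IsNoetherianRing B] {ι : Type*}
    [Fintype ι] [Algebra (MvPolynomial ι k) B] [IsScalarTower k (MvPolynomial ι k) B]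
    {g : MvPolynomial ι k} (hg : FlatAway g B) (ev : B →ₐ[k] k)
    (hev : ev (algebraMap _ B g) ≠ 0) :
    ringKrullDim (LocalRingPt ev ⧸ Ideal.span (Set.range (localShift ev fun i =>
      algebraMap (MvPolynomial ι k) B (MvPolynomial.X i)))) + Fintype.card ι ≤
        ringKrullDim (LocalRingPt ev) := by
  let A := MvPolynomial ι k
  let t : ι → B := fun i => algebraMap A B (MvPolynomial.X i)
  let evA : A →ₐ[k] k := ev.comp (IsScalarTower.toAlgHom k A B)
  let R := LocalRingPt ev
  let p := ptIdeal evA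
  let P := maximalIdeal R
  have hflat : Module.Flat A R := hg.flat_localization (ptIdeal ev).primeCompl
    (fun h => hev (mem_ptIdeal.1 h))
  have hover : P.LiesOver p := by
    refine ⟨?_⟩
    ext a
    rw [Ideal.under_def, Ideal.mem_comap, IsScalarTower.algebraMap_apply A B R,
      IsLocalization.AtPrime.to_map_mem_maximal_iff _ (ptIdeal ev), mem_ptIdeal, mem_ptIdeal]
    rfl
  have hmap : p.map (algebraMap A R) = Ideal.span (Set.range (localShift ev t)) := by
    rw [show p = _ from ptIdeal_mvPolynomial evA, Ideal.map_span, ← Set.range_comp]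
    congr 2
    funext i
    simp only [Function.comp, shift, localShift, IsScalarTower.algebraMap_apply A B R, map_sub, t]
    rw [← IsScalarTower.algebraMap_apply k A B]
    rfl
  -- Flatness gives going-down, hence ht P = ht p + ht (P/pR), where ht p ≥ d because p is a
  -- rational point of affine space.
  have hht := Ideal.height_eq_height_add_of_liesOver_of_hasGoingDown p P
  rw [hmap] at hht
  have := isLocalRing_quotient_span_range (localShift_mem ev t)
  rw [maximalIdeal_quotient_eq_map] at hht
  have h1 := maximalIdeal_height_eq_ringKrullDim (R := R)
  have h2 := maximalIdeal_height_eq_ringKrullDim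
    (R := R ⧸ Ideal.span (Set.range (localShift ev t)))
  rw [← h1, ← h2, hht, add_comm]
  have := card_le_height_ptIdeal evA
  exact_mod_cast add_le_add_left this _

end Dimension

end SingularFibers

/-! ### Regularity at general points in characteristic zero. -/

namespace SingularFibers

open IsLocalRing

theorem maximalIdeal_eq_span_of_le_sup_sq {R : Type*} [CommRing R] [IsLocalRing R]
    [IsNoetherianRing R] {J : Ideal R} (hJ : J ≤ maximalIdeal R)
    (h : maximalIdeal R ≤ J ⊔ maximalIdeal R ^ 2) : J = maximalIdeal R := by
  refine le_antisymm hJ (Submodule.le_of_le_smul_of_le_jacobson_bot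
    (maximalIdeal R).fg_of_isNoetherianRing (maximalIdeal_le_jacobson _) ?_)
  rwa [smul_eq_mul, ← pow_two]

/-- A local ring of dimension at least `d` whose maximal ideal is generated by `d` elements is
regular, and the generators are cotangent independent. -/
theorem isRegularLocalRing_and_cotangentIndependent {R ι : Type*} [CommRing R] [IsLocalRing R]
    [IsNoetherianRing R] [Fintype ι] {τ : ι → R} (hτ : Ideal.span (Set.range τ) = maximalIdeal R)
    (hdim : (Fintype.card ι : WithBot ℕ∞) ≤ ringKrullDim R) :
    IsRegularLocalRing R ∧ CotangentIndependent τ := by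
  classical
  refine ⟨IsRegularLocalRing.of_spanFinrank_maximalIdeal_le R (le_trans ?_ hdim), ?_⟩
  · rw [← hτ]
    exact_mod_cast spanFinrank_range_le τ
  intro a ha i
  by_contra hu
  have hu : IsUnit (a i) := by simpa using hu
  -- If aᵢ is a unit, τᵢ is redundant modulo 𝔪², so by Nakayama the other d - 1 elements generate 𝔪,
  -- against dim R ≥ d.
  let σ : {j // j ≠ i} → R := fun j => τ j
  have hmem : ∀ j, τ j ∈ maximalIdeal R := fun j => hτ ▸ Ideal.subset_span ⟨j, rfl⟩
  have hσ : Ideal.span (Set.range σ) = maximalIdeal R := by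
    refine maximalIdeal_eq_span_of_le_sup_sq
      (span_range_le_maximalIdeal fun j => hmem j) ?_
    conv_lhs => rw [← hτ]
    refine Ideal.span_le.2 ?_
    rintro _ ⟨j, rfl⟩
    have hmemσ : ∀ j ≠ i, τ j ∈ Ideal.span (Set.range σ) ⊔ maximalIdeal R ^ 2 := fun j hj =>
      Ideal.mem_sup_left (Ideal.subset_span ⟨⟨j, hj⟩, rfl⟩)
    by_cases hj : j = i
    · subst hj
      rw [SetLike.mem_coe, ← Ideal.unit_mul_mem_iff_mem _ hu]
      rw [← Finset.add_sum_erase _ _ (Finset.mem_univ j)] at ha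
      have hsum : ∑ l ∈ Finset.univ.erase j, a l * τ l ∈
          Ideal.span (Set.range σ) ⊔ maximalIdeal R ^ 2 :=
        Ideal.sum_mem _ fun l hl => Ideal.mul_mem_left _ _ (hmemσ l (Finset.ne_of_mem_erase hl))
      simpa using sub_mem (Ideal.mem_sup_right ha) hsum
    · exact hmemσ j hj
  have h1 := hdim.trans (ringKrullDim_le_spanFinrank_maximalIdeal R)
  have h2 := spanFinrank_range_le σ
  rw [hσ] at h2
  have h3 : Fintype.card ι ≤ (maximalIdeal R).spanFinrank := by exact_mod_cast h1
  have h4 : Fintype.card {j // j ≠ i} < Fintype.card ι :=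
    Fintype.card_subtype_lt (x := i) (by simp)
  omega

/-- Take F of minimal degree: in characteristic zero F' is nonzero of smaller degree, so it cannot
kill c. -/
theorem exists_polynomial_derivative_ne_zero {A C : Type*} [CommRing A] [IsDomain A] [CharZero A]
    [CommRing C] [Algebra A C] [FaithfulSMul A C] {c : C} (hc : IsAlgebraic A c) :
    ∃ F : Polynomial A, Polynomial.aeval c F = 0 ∧
      Polynomial.aeval c (Polynomial.derivative F) ≠ 0 := by
  obtain ⟨F, hF, hmin⟩ := WellFounded.has_min (measure (Polynomial.natDegree (R := A))).wf
    {F | F ≠ 0 ∧ Polynomial.aeval c F = 0} hc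
  refine ⟨F, hF.2, fun h => ?_⟩
  have hdeg : F.natDegree ≠ 0 := by
    intro h0
    rw [Polynomial.natDegree_eq_zero] at h0
    obtain ⟨a, rfl⟩ := h0
    have := hF.2
    rw [Polynomial.aeval_C, FaithfulSMul.algebraMap_eq_zero_iff] at this
    exact hF.1 (by rw [this, Polynomial.C_0])
  refine hmin (Polynomial.derivative F) ⟨fun h0 => hdeg ?_, h⟩
    (Polynomial.natDegree_derivative_lt hdeg)
  exact Polynomial.derivative_eq_zero.1 h0

variable {k : Type*} [Field k]

/-- If `F(c) = 0` for a polynomial `F` whose coefficients are constant modulo `I`, then `c` is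
constant modulo `I` at the points where `F'(c)` does not vanish. -/
theorem mem_constantModulo_of_derivative_ne_zero {C : Type*} [CommRing C] [Algebra k C]
    {ev : C →ₐ[k] k} {I : Ideal C} {A : Subalgebra k C} (hA : A ≤ constantModulo ev I)
    (hI : ptIdeal ev ^ 2 ≤ I) {c : C} {F : Polynomial A} (hF : Polynomial.aeval c F = 0)
    (hF' : ev (Polynomial.aeval c (Polynomial.derivative F)) ≠ 0) : c ∈ constantModulo ev I := by
  let G : Polynomial C := F.map (algebraMap A C)
  let γ : C := algebraMap k C (ev c)
  have hev : ∀ H : Polynomial C, ev (H.eval γ) = ev (H.eval c) := by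
    intro H
    have := Polynomial.sub_dvd_eval_sub γ c H
    have h0 : ev (H.eval γ - H.eval c) = 0 := by
      obtain ⟨d, hd⟩ := this
      rw [hd, map_mul, map_sub]
      simp [γ]
    rwa [map_sub, sub_eq_zero] at h0
  have hmem : ∀ H : Polynomial A, (H.map (algebraMap A C)).eval γ ∈ constantModulo ev I := by
    intro H
    rw [Polynomial.eval_map, Polynomial.eval₂_eq_sum]
    refine sum_mem fun i _ => mul_mem (hA (H.coeff i).2) (pow_mem (Subalgebra.algebraMap_mem _ _) _)
  have hG : G.eval c = 0 := by rwa [Polynomial.eval_map, ← Polynomial.aeval_def]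
  have h1 : G.eval γ ∈ I := by
    have := mem_constantModulo.1 (hmem F)
    rwa [hev, hG, map_zero, map_zero, sub_zero] at this
  have hu : Polynomial.aeval c (Polynomial.derivative F) = (Polynomial.derivative G).eval c := by
    rw [Polynomial.derivative_map, Polynomial.eval_map, ← Polynomial.aeval_def]
  rw [hu] at hF'
  have h2 := mem_constantModulo.1 (hmem (Polynomial.derivative F))
  rw [← Polynomial.derivative_map, hev] at h2
  set u := ev ((Polynomial.derivative G).eval c)
  -- Taylor expansion: 0 = G(γ) + G'(γ)(c - γ) + q(c - γ)². Modulo I the first and last terms vanish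
  -- and G'(γ) is the nonzero constant u, so c - γ lies in I.
  obtain ⟨q, hq⟩ := Polynomial.binomExpansion G γ (c - γ)
  rw [add_sub_cancel, hG] at hq
  have hsq : (c - γ) ^ 2 ∈ I := hI (Ideal.pow_mem_pow (mem_ptIdeal.2 (eval_sub_algebraMap ev c)) 2)
  have h3 : algebraMap k C u * (c - γ) ∈ I := by
    have : algebraMap k C u * (c - γ) = -(G.eval γ) -
        ((Polynomial.derivative G).eval γ - algebraMap k C u) * (c - γ) - q * (c - γ) ^ 2 := by
      linear_combination -hq
    rw [this]
    exact sub_mem (sub_mem (neg_mem h1) (I.mul_mem_right _ h2)) (I.mul_mem_left _ hsq)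
  rwa [Ideal.unit_mul_mem_iff_mem _ ((IsUnit.mk0 u hF').map (algebraMap k C))] at h3

/-- Functions over which the coordinate ring is algebraic generate the cotangent spaces at general
points. -/
theorem exists_forall_ptIdeal_le_span_shift_sup_sq [CharZero k] {C : Type*} [CommRing C]
    [IsDomain C] [Algebra k C] [Algebra.FiniteType k C] {ι : Type*} (t : ι → C)
    [Algebra.IsAlgebraic (Algebra.adjoin k (Set.range t)) C] :
    ∃ δ : C, δ ≠ 0 ∧ ∀ ev : C →ₐ[k] k, ev δ ≠ 0 →
      ptIdeal ev ≤ Ideal.span (Set.range (shift ev t)) ⊔ ptIdeal ev ^ 2 := by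
  obtain ⟨s, hs⟩ := (inferInstance : Algebra.FiniteType k C).out
  have : CharZero (Algebra.adjoin k (Set.range t)) := charZero_of_injective_algebraMap
    (FaithfulSMul.algebraMap_injective k _)
  choose F hF hF' using fun c : C => exists_polynomial_derivative_ne_zero
    (Algebra.IsAlgebraic.isAlgebraic (R := Algebra.adjoin k (Set.range t)) c)
  -- δ is the product of the values F'(c) over a finite set of algebra generators c, so each
  -- generator is constant modulo (t - t(x)) + 𝔪² wherever δ ≠ 0.
  refine ⟨∏ c ∈ s, Polynomial.aeval c (Polynomial.derivative (F c)),
    Finset.prod_ne_zero_iff.2 fun c _ => hF' c, fun ev hev => ?_⟩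
  rw [map_prod, Finset.prod_ne_zero_iff] at hev
  refine ptIdeal_le_of_adjoin_eq_top hs fun c hc => ?_
  refine mem_constantModulo_of_derivative_ne_zero (Algebra.adjoin_le ?_) le_sup_right (hF c)
    (hev c hc)
  rintro _ ⟨i, rfl⟩
  exact Ideal.mem_sup_left (Ideal.subset_span ⟨i, rfl⟩)

/-- The local ring at a general point of a variety is regular, and a transcendence basis gives a
regular system of parameters. -/
theorem exists_forall_isRegularLocalRing [IsAlgClosed k] [CharZero k] {C : Type*} [CommRing C]
    [IsDomain C] [Algebra k C] [Algebra.FiniteType k C] {ι : Type*} [Fintype ι] {t : ι → C}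
    (ht : IsTranscendenceBasis k t) :
    ∃ h : C, h ≠ 0 ∧ ∀ ev : C →ₐ[k] k, ev h ≠ 0 →
      IsRegularLocalRing (LocalRingPt ev) ∧ CotangentIndependent (localShift ev t) := by
  have := ht.isAlgebraic
  obtain ⟨δ, hδ, hgen⟩ := exists_forall_ptIdeal_le_span_shift_sup_sq (k := k) t
  let : Algebra (MvPolynomial ι k) C := (MvPolynomial.aeval t).toAlgebra
  have : IsScalarTower k (MvPolynomial ι k) C := IsScalarTower.of_algHom (MvPolynomial.aeval t)
  have : Algebra.FiniteType (MvPolynomial ι k) C := .of_restrictScalars_finiteType k _ _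
  have : IsNoetherianRing C := Algebra.FiniteType.isNoetherianRing k C
  obtain ⟨g, hg, hflat⟩ := genericallyFlat_of_finiteType (MvPolynomial ι k) C C
  have hg' : algebraMap (MvPolynomial ι k) C g ≠ 0 := fun h0 =>
    hg (ht.1 (by rw [map_zero]; exact h0))
  have htX : (fun i => algebraMap (MvPolynomial ι k) C (MvPolynomial.X i)) = t :=
    funext fun i => MvPolynomial.aeval_X t i
  refine ⟨δ * algebraMap _ C g, mul_ne_zero hδ hg', fun ev hev => ?_⟩
  rw [map_mul, mul_ne_zero_iff] at hev
  have hdim := ringKrullDim_add_card_le_of_flatAway hflat ev hev.2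
  rw [htX] at hdim
  have hspan : Ideal.span (Set.range (localShift ev t)) = maximalIdeal (LocalRingPt ev) := by
    refine maximalIdeal_eq_span_of_le_sup_sq (span_range_le_maximalIdeal (localShift_mem ev t)) ?_
    have := Ideal.map_mono (f := algebraMap C (LocalRingPt ev)) (hgen ev hev.1)
    rwa [Ideal.map_sup, Ideal.map_pow, map_span_shift, Localization.AtPrime.map_eq_maximalIdeal]
      at this
  refine isRegularLocalRing_and_cotangentIndependent hspan (le_trans ?_ hdim)
  rw [add_comm]
  refine le_add_of_nonneg_right ?_
  have := isLocalRing_quotient_span_range (localShift_mem ev t)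
  exact ringKrullDim_nonneg_of_nontrivial

end SingularFibers

/-! ### Generic submersivity and reducedness of fibers over affine space. -/

namespace SingularFibers

open IsLocalRing

theorem CotangentIndependent.comp_injective {R ι κ : Type*} [CommRing R] [IsLocalRing R]
    [Fintype ι] [Fintype κ] {τ : ι → R} (h : CotangentIndependent τ) {f : κ → ι}
    (hf : Function.Injective f) : CotangentIndependent (τ ∘ f) := by
  classical
  intro a ha j
  let b : ι → R := fun i => ∑ l, if f l = i then a l else 0
  have hb : b (f j) = a j := by
    simp [b, hf.eq_iff]
  rw [← hb]
  refine h b ?_ _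
  convert ha using 1
  simp only [b, Finset.sum_mul, ite_mul, zero_mul]
  rw [Finset.sum_comm]
  simp

theorem CotangentIndependent.of_map {R R' ι : Type*} [CommRing R] [IsLocalRing R] [CommRing R']
    [IsLocalRing R'] [Fintype ι] {τ : ι → R} (φ : R →+* R') [IsLocalHom φ]
    (h : CotangentIndependent (φ ∘ τ)) : CotangentIndependent τ := by
  intro a ha i
  have hle : (maximalIdeal R).map φ ≤ maximalIdeal R' :=
    Ideal.map_le_iff_le_comap.2 (maximalIdeal_comap φ).ge
  have := h (φ ∘ a) (by
    have := Ideal.mem_map_of_mem φ ha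
    rw [Ideal.map_pow] at this
    simpa using Ideal.pow_right_mono hle 2 this) i
  rw [← maximalIdeal_comap φ]
  exact this

variable {k : Type*} [Field k]

theorem exists_finite_isTranscendenceBasis_superset {C : Type*} [CommRing C] [IsDomain C]
    [Algebra k C] [Algebra.FiniteType k C] {ι : Type*} [Finite ι] {t : ι → C}
    (ht : AlgebraicIndependent k t) :
    ∃ u : Set C, u.Finite ∧ Set.range t ⊆ u ∧ IsTranscendenceBasis k ((↑) : u → C) := by
  obtain ⟨s, hs⟩ := (inferInstance : Algebra.FiniteType k C).out
  have htop : Algebra.adjoin k (Set.range t ∪ (s : Set C)) = ⊤ :=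
    top_le_iff.1 (hs ▸ Algebra.adjoin_mono Set.subset_union_right)
  have : Algebra.IsAlgebraic (Algebra.adjoin k (Set.range t ∪ (s : Set C))) C := by
    refine ⟨fun c => ?_⟩
    have hc : c ∈ Algebra.adjoin k (Set.range t ∪ (s : Set C)) := htop ▸ Algebra.mem_top
    exact isAlgebraic_algebraMap (⟨c, hc⟩ : Algebra.adjoin k (Set.range t ∪ (s : Set C)))
  obtain ⟨u, htu, hus, hu⟩ := exists_isTranscendenceBasis_between (R := k) (Set.range t)
    (Set.range t ∪ (s : Set C)) Set.subset_union_left ht.coe_range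
  exact ⟨u, ((Set.finite_range t).union s.finite_toSet).subset hus, htu, hu⟩

/-- If the `tᵢ` are algebraically independent on the variety of a prime `I`, then their
differentials are independent at the general points of this variety. -/
theorem exists_cotangentIndependent_of_isPrime [IsAlgClosed k] [CharZero k] {B : Type*}
    [CommRing B] [Algebra k B] [Algebra.FiniteType k B] {ι : Type*} [Fintype ι] {t : ι → B}
    (I : Ideal B) [I.IsPrime]
    (ht : AlgebraicIndependent k (Ideal.Quotient.mk I ∘ t)) :
    ∃ h ∉ I, ∀ ev : B →ₐ[k] k, I ≤ ptIdeal ev → ev h ≠ 0 →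
      CotangentIndependent (localShift ev t) := by
  obtain ⟨u, hufin, htu, hu⟩ := exists_finite_isTranscendenceBasis_superset ht
  have := hufin.fintype
  obtain ⟨h, hh, hreg⟩ := exists_forall_isRegularLocalRing hu
  obtain ⟨h, rfl⟩ := Ideal.Quotient.mk_surjective h
  refine ⟨h, fun hI => hh (Ideal.Quotient.eq_zero_iff_mem.2 hI), fun ev hev hne => ?_⟩
  let evC : (B ⧸ I) →ₐ[k] k := Ideal.Quotient.liftₐ I ev fun b hb => mem_ptIdeal.1 (hev hb)
  have hind := (hreg evC hne).2
  let f : ι → u := fun i => ⟨Ideal.Quotient.mk I (t i), htu ⟨i, rfl⟩⟩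
  have hf : Function.Injective f := fun i j hij => ht.injective (congrArg Subtype.val hij)
  -- Independence in the cotangent space of the subvariety lifts along this local map, even where B
  -- is not regular.
  let φ : LocalRingPt ev →+* LocalRingPt evC :=
    Localization.localRingHom (ptIdeal ev) (ptIdeal evC) (Ideal.Quotient.mk I) rfl
  have : IsLocalHom φ := Localization.isLocalHom_localRingHom _ _ _ rfl
  refine CotangentIndependent.of_map φ ?_
  convert hind.comp_injective hf using 1
  funext i
  exact Localization.localRingHom_to_map _ _ _ rfl (shift ev t i)

/-- Generic submersivity: over a dense open subset of affine space, the differentials of the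
coordinates are independent on the cotangent spaces of a variety, even at its singular points. -/
theorem exists_forall_cotangentIndependent [IsAlgClosed k] [CharZero k] {B : Type*}
    [CommRing B] [Algebra k B] [Algebra.FiniteType k B] {ι : Type*} [Fintype ι] (t : ι → B)
    (I : Ideal B) :
    ∃ g : MvPolynomial ι k, g ≠ 0 ∧ ∀ ev : B →ₐ[k] k, I ≤ ptIdeal ev →
      ev (MvPolynomial.aeval t g) ≠ 0 → CotangentIndependent (localShift ev t) := by
  have : IsNoetherianRing B := Algebra.FiniteType.isNoetherianRing k B
  induction I using WellFoundedGT.induction with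
  | _ I ih =>
  by_cases htop : I = ⊤
  · refine ⟨1, one_ne_zero, fun ev hev => ?_⟩
    rw [htop, top_le_iff] at hev
    exact absurd hev (Ideal.IsPrime.ne_top inferInstance)
  by_cases hI : I.IsPrime
  · by_cases ht : AlgebraicIndependent k (Ideal.Quotient.mk I ∘ t)
    · obtain ⟨h, hh, hind⟩ := exists_cotangentIndependent_of_isPrime I ht
      -- Points of the subvariety with h ≠ 0 are good already; the smaller closed set h = 0 is left
      -- to the induction.
      obtain ⟨g, hg, hgood⟩ := ih (I ⊔ Ideal.span {h}) (by
        rw [left_lt_sup, Ideal.span_singleton_le_iff_mem]; exact hh)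
      refine ⟨g, hg, fun ev hev hne => ?_⟩
      by_cases h0 : ev h = 0
      · exact hgood ev (sup_le hev (by
          rw [Ideal.span_singleton_le_iff_mem]; exact mem_ptIdeal.2 h0)) hne
      · exact hind ev hev h0
    · rw [algebraicIndependent_iff] at ht
      push Not at ht
      obtain ⟨g, hg0, hg⟩ := ht
      -- The image in affine space lies in the hypersurface g = 0, so no point satisfies the
      -- condition.
      refine ⟨g, hg, fun ev hev hne => absurd (hev ?_) (fun h => hne (mem_ptIdeal.1 h))⟩
      have : Ideal.Quotient.mkₐ k I (MvPolynomial.aeval t g) = 0 := by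
        rw [← hg0, ← AlgHom.comp_apply, MvPolynomial.comp_aeval]
        rfl
      exact Ideal.Quotient.eq_zero_iff_mem.1 this
  -- With ab ∈ I, the zero set of I is the union of those of I + (a) and I + (b).
  · obtain ⟨a, b, hab, ha, hb⟩ : ∃ a b, a * b ∈ I ∧ a ∉ I ∧ b ∉ I := by
      by_contra! hcon
      exact hI ⟨htop, fun {a b} hab => or_iff_not_imp_left.2 fun ha => hcon a b hab ha⟩
    obtain ⟨g₁, hg₁, h₁⟩ := ih (I ⊔ Ideal.span {a}) (by
      rw [left_lt_sup, Ideal.span_singleton_le_iff_mem]; exact ha)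
    obtain ⟨g₂, hg₂, h₂⟩ := ih (I ⊔ Ideal.span {b}) (by
      rw [left_lt_sup, Ideal.span_singleton_le_iff_mem]; exact hb)
    refine ⟨g₁ * g₂, mul_ne_zero hg₁ hg₂, fun ev hev hne => ?_⟩
    rw [map_mul, map_mul, mul_ne_zero_iff] at hne
    rcases (inferInstance : (ptIdeal ev).IsPrime).mem_or_mem (hev hab) with h | h
    · exact h₁ ev (sup_le hev ((Ideal.span_singleton_le_iff_mem _).2 h)) hne.1
    · exact h₂ ev (sup_le hev ((Ideal.span_singleton_le_iff_mem _).2 h)) hne.2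

theorem aeval_eq_of_span_shift_le {B : Type*} [CommRing B] [Algebra k B] {ι : Type*} {t : ι → B}
    {ev ev' : B →ₐ[k] k} (h : Ideal.span (Set.range (shift ev t)) ≤ ptIdeal ev') :
    (∀ i, ev' (t i) = ev (t i)) ∧
      ∀ g : MvPolynomial ι k, ev' (MvPolynomial.aeval t g) = ev (MvPolynomial.aeval t g) := by
  have h1 : ∀ i, ev' (t i) = ev (t i) := fun i => by
    have := mem_ptIdeal.1 (h (Ideal.subset_span ⟨i, rfl⟩))
    simpa [shift, sub_eq_zero] using this
  refine ⟨h1, fun g => ?_⟩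
  rw [← AlgHom.comp_apply, ← AlgHom.comp_apply, MvPolynomial.comp_aeval, MvPolynomial.comp_aeval]
  simp only [h1]

/-- At a point of the fiber with δ ≠ 0 the local ring of the scheme-theoretic fiber is regular,
hence a domain, so the nilpotent u vanishes there. Thus δ vanishes at all zeros of the colon ideal
(J : u), and the Nullstellensatz applies. -/
theorem exists_pow_mul_mem_span_shift [IsAlgClosed k] {B : Type*} [CommRing B] [Algebra k B]
    [Algebra.FiniteType k B] {ι : Type*} [Fintype ι] {t : ι → B} {ev : B →ₐ[k] k} {δ : B}
    (hreg : ∀ ev' : B →ₐ[k] k, ev' δ ≠ 0 → IsRegularLocalRing (LocalRingPt ev'))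
    (hind : ∀ ev' : B →ₐ[k] k, Ideal.span (Set.range (shift ev t)) ≤ ptIdeal ev' →
      CotangentIndependent (localShift ev' t)) {u : B} {n : ℕ}
    (hu : u ^ n ∈ Ideal.span (Set.range (shift ev t))) :
    ∃ l, δ ^ l * u ∈ Ideal.span (Set.range (shift ev t)) := by
  set J := Ideal.span (Set.range (shift ev t)) with hJ
  suffices δ ∈ (J.colon {u}).radical by
    obtain ⟨l, hl⟩ := this
    exact ⟨l, by simpa using Submodule.mem_colon_singleton.1 hl⟩
  refine mem_radical_of_forall_pt (k := k) fun ev' hle => ?_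
  by_contra hδ
  have hJle : J ≤ ptIdeal ev' := le_trans
    (fun c hc => Submodule.mem_colon_singleton.2 (J.mul_mem_right _ hc)) hle
  have hshift : shift ev t = shift ev' t := by
    funext i
    rw [shift, shift, (aeval_eq_of_span_shift_le hJle).1]
  have := hreg ev' hδ
  have := IsRegularLocalRing.quotient_span_range (localShift_mem ev' t) (hind ev' hJle)
  have hdom := IsRegularLocalRing.isDomain
    (LocalRingPt ev' ⧸ Ideal.span (Set.range (localShift ev' t)))
  rw [Ideal.Quotient.isDomain_iff_prime] at hdom
  have hmem : algebraMap B (LocalRingPt ev') u ∈ Ideal.span (Set.range (localShift ev' t)) := by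
    refine hdom.mem_of_pow_mem n ?_
    rw [← map_pow, ← map_span_shift, ← hshift]
    exact Ideal.mem_map_of_mem _ hu
  rw [← map_span_shift, ← hshift,
    IsLocalization.algebraMap_mem_map_algebraMap_iff (ptIdeal ev').primeCompl] at hmem
  obtain ⟨s, hs, hsu⟩ := hmem
  exact hs (hle (Submodule.mem_colon_singleton.2 hsu))

/-- δ is a nonzerodivisor on the fiber up to powers of g; but g is a nonzero constant modulo the
ideal of the fiber, so these powers cancel. -/
theorem mem_span_shift_of_mul_mem {B : Type*} [CommRing B] [IsDomain B] [Algebra k B] {d : ℕ}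
    [Algebra (MvPolynomial (Fin d) k) B] [IsScalarTower k (MvPolynomial (Fin d) k) B]
    {t : Fin d → B} (ht : ∀ i, algebraMap (MvPolynomial (Fin d) k) B (MvPolynomial.X i) = t i)
    {δ : B} (hδ : δ ≠ 0) {g : MvPolynomial (Fin d) k} (hg : FlatAway g (B ⧸ Ideal.span {δ}))
    {ev : B →ₐ[k] k} (hev : ev (algebraMap _ B g) ≠ 0) {u : B}
    (hu : δ * u ∈ Ideal.span (Set.range (shift ev t))) :
    u ∈ Ideal.span (Set.range (shift ev t)) := by
  let τ : Fin d → MvPolynomial (Fin d) k := fun i => MvPolynomial.X i - MvPolynomial.C (ev (t i))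
  have hC : ∀ c : k, algebraMap (MvPolynomial (Fin d) k) B (MvPolynomial.C c) = algebraMap k B c :=
    fun c => (IsScalarTower.algebraMap_apply k (MvPolynomial (Fin d) k) B c).symm
  have hτ : (fun i => algebraMap (MvPolynomial (Fin d) k) B (τ i)) = shift ev t := by
    funext i
    simp only [τ, shift, map_sub, ht, hC]
  rw [← hτ] at hu
  obtain ⟨l, hl⟩ := hg.exists_pow_mul_mem (mem_nonZeroDivisors_of_ne_zero hδ) τ hu
  rw [hτ] at hl
  set J := Ideal.span (Set.range (shift ev t)) with hJ
  have hconst : ∀ p : MvPolynomial (Fin d) k,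
      algebraMap (MvPolynomial (Fin d) k) B p ∈ constantModulo ev J := by
    intro p
    induction p using MvPolynomial.induction_on with
    | C c => rw [hC]; exact Subalgebra.algebraMap_mem _ _
    | add p q hp hq => rw [map_add]; exact add_mem hp hq
    | mul_X p i hp =>
      rw [map_mul, ht]
      exact mul_mem hp (Ideal.subset_span ⟨i, rfl⟩)
  have h1 := mem_constantModulo.1 (pow_mem (hconst g) l)
  have h2 := sub_mem hl (J.mul_mem_right u h1)
  rw [← sub_mul, sub_sub_cancel] at h2
  refine (Ideal.unit_mul_mem_iff_mem _ ((IsUnit.mk0 _ ?_).map (algebraMap k B))).1 h2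
  rw [map_pow]
  exact pow_ne_zero _ hev

/-- Over a dense open subset of affine space, the scheme-theoretic fibers of a dominant morphism
from a variety are reduced, and their local rings are regular exactly where those of the variety
are. -/
theorem exists_forall_isRegularLocalRing_iff [IsAlgClosed k] [CharZero k] {B : Type*}
    [CommRing B] [IsDomain B] [Algebra k B] [Algebra.FiniteType k B] {d : ℕ} {t : Fin d → B}
    (ht : AlgebraicIndependent k t) :
    ∃ g : MvPolynomial (Fin d) k, g ≠ 0 ∧ ∀ ev : B →ₐ[k] k, ev (MvPolynomial.aeval t g) ≠ 0 →
      (IsRegularLocalRing (LocalRingPt ev ⧸ Ideal.span (Set.range (localShift ev t))) ↔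
        IsRegularLocalRing (LocalRingPt ev)) ∧ (Ideal.span (Set.range (shift ev t))).IsRadical := by
  have : IsNoetherianRing B := Algebra.FiniteType.isNoetherianRing k B
  obtain ⟨u, hufin, -, hu⟩ := exists_finite_isTranscendenceBasis_superset (k := k) ht
  have := hufin.fintype
  obtain ⟨δ, hδ, hδreg⟩ := exists_forall_isRegularLocalRing (k := k) hu
  obtain ⟨g₁, hg₁, hind⟩ := exists_forall_cotangentIndependent (k := k) t ⊥
  let : Algebra (MvPolynomial (Fin d) k) B := (MvPolynomial.aeval t).toAlgebra
  have : IsScalarTower k (MvPolynomial (Fin d) k) B :=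
    IsScalarTower.of_algHom (MvPolynomial.aeval t)
  have : Algebra.FiniteType (MvPolynomial (Fin d) k) B := .of_restrictScalars_finiteType k _ _
  obtain ⟨g₂, hg₂, hflat⟩ := genericallyFlat_of_finiteType (MvPolynomial (Fin d) k) B B
  obtain ⟨g₃, hg₃, hflatδ⟩ := genericallyFlat_of_finiteType (MvPolynomial (Fin d) k) B
    (B ⧸ Ideal.span {δ})
  have htX : ∀ i, algebraMap (MvPolynomial (Fin d) k) B (MvPolynomial.X i) = t i :=
    MvPolynomial.aeval_X t
  refine ⟨g₁ * g₂ * g₃, mul_ne_zero (mul_ne_zero hg₁ hg₂) hg₃, fun ev hev => ?_⟩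
  simp only [map_mul, mul_ne_zero_iff] at hev
  obtain ⟨⟨hev₁, hev₂⟩, hev₃⟩ := hev
  refine ⟨⟨fun h => ?_, fun h => ?_⟩, fun u ⟨n, hn⟩ => ?_⟩
  · refine IsRegularLocalRing.of_quotient_span_range (localShift_mem ev t) ?_ h
    have := ringKrullDim_add_card_le_of_flatAway hflat ev hev₂
    rwa [funext htX] at this
  · exact IsRegularLocalRing.quotient_span_range (localShift_mem ev t) (hind ev bot_le hev₁)
  -- A nilpotent u on the fiber is killed by some δˡ; the factors δ are then cancelled one at a
  -- time. The function g₁ is constant along the fiber, so submersivity holds at all of its points.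
  · obtain ⟨l, hl⟩ := exists_pow_mul_mem_span_shift (k := k) (fun ev' h => (hδreg ev' h).1)
      (fun ev' h => hind ev' bot_le (by rwa [(aeval_eq_of_span_shift_le h).2])) hn
    induction l with
    | zero => simpa using hl
    | succ l ih =>
      rw [pow_succ', mul_assoc] at hl
      exact ih (mem_span_shift_of_mul_mem htX hδ hflatδ hev₃ hl)

end SingularFibers

/-! ### From coordinate rings to varieties and their reduced fibers. -/

namespace SingularFibers

open MvPolynomial

theorem isAffineVariety_iff {n : ℕ} {V : Set (Fin n → ℂ)} :
    IsAffineVariety V ↔ ∃ I : Ideal (MvPolynomial (Fin n) ℂ), V = zeroLocus ℂ I := by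
  rw [IsAffineVariety, ← @isOpen_compl_iff _ _ (zariski n)]
  change Vᶜᶜ ∈ _ ↔ _
  rw [compl_compl]
  rfl

theorem IsAffineVariety.mem_of_forall {n : ℕ} {V : Set (Fin n → ℂ)} (hV : IsAffineVariety V)
    {x : Fin n → ℂ} (hx : ∀ p ∈ vanishingIdeal ℂ V, aeval x p = 0) : x ∈ V := by
  obtain ⟨I, rfl⟩ := isAffineVariety_iff.1 hV
  exact mem_zeroLocus_iff.2 fun p hp => hx p (mem_vanishingIdeal_iff.2 fun y hy => hy p hp)

theorem subset_zariski_closure_iff {n : ℕ} {S V : Set (Fin n → ℂ)} :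
    V ⊆ @closure _ (zariski n) S ↔ vanishingIdeal ℂ S ≤ vanishingIdeal ℂ V := by
  constructor
  · intro h p hp
    refine mem_vanishingIdeal_iff.2 fun x hx => ?_
    have hclosed : IsAffineVariety (zeroLocus ℂ (vanishingIdeal ℂ S)) :=
      isAffineVariety_iff.2 ⟨_, rfl⟩
    have hsub : S ⊆ zeroLocus ℂ (vanishingIdeal ℂ S) := fun y hy =>
      mem_zeroLocus_iff.2 fun q hq => hq y hy
    have hle : @closure _ (zariski n) S ⊆ zeroLocus ℂ (vanishingIdeal ℂ S) :=
      @closure_minimal _ (zariski n) _ _ hsub hclosed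
    exact hle (h hx) p hp
  · intro h x hx
    have hclosed : IsAffineVariety (@closure _ (zariski n) S) := @isClosed_closure _ (zariski n) S
    refine hclosed.mem_of_forall fun p hp => h ?_ x hx
    exact mem_vanishingIdeal_iff.2 fun y hy => hp y (@subset_closure _ (zariski n) S y hy)

theorem IsZariskiIrreducible.isDomain_coordinateRing {n : ℕ} {V : Set (Fin n → ℂ)}
    (hV : IsZariskiIrreducible V) : IsDomain (CoordinateRing V) := by
  obtain ⟨⟨x, hx⟩, hirr⟩ := hV
  rw [Ideal.Quotient.isDomain_iff_prime]
  refine ⟨fun h => ?_, fun {p q} hpq => ?_⟩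
  · have : (1 : MvPolynomial (Fin n) ℂ) ∈ vanishingIdeal ℂ V := h ▸ Submodule.mem_top
    simpa using mem_vanishingIdeal_iff.1 this x hx
  · have hclosed : ∀ r : MvPolynomial (Fin n) ℂ, IsAffineVariety {y | aeval y r = 0} := fun r =>
      isAffineVariety_iff.2 ⟨Ideal.span {r}, by
        ext y; rw [zeroLocus_span]; simp⟩
    have hcover : V ⊆ {y | aeval y p = 0} ∪ {y | aeval y q = 0} := fun y hy => by
      have := mem_vanishingIdeal_iff.1 hpq y hy
      rw [map_mul] at this
      exact mul_eq_zero.1 this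
    rcases (@isPreirreducible_iff_isClosed_union_isClosed _ (zariski n) V).1 hirr _ _ (hclosed p)
      (hclosed q) hcover with h | h
    · exact Or.inl (mem_vanishingIdeal_iff.2 fun y hy => h hy)
    · exact Or.inr (mem_vanishingIdeal_iff.2 fun y hy => h hy)

theorem evalAt_mk {n : ℕ} (V : Set (Fin n → ℂ)) (x : V) (p : MvPolynomial (Fin n) ℂ) :
    evalAt V x (Ideal.Quotient.mk _ p) = aeval (x : Fin n → ℂ) p := rfl

theorem IsAffineVariety.exists_evalAt_eq {n : ℕ} {V : Set (Fin n → ℂ)} (hV : IsAffineVariety V)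
    (ev : CoordinateRing V →ₐ[ℂ] ℂ) : ∃ x : V, evalAt V x = ev := by
  let x : Fin n → ℂ := fun i => ev (Ideal.Quotient.mk _ (X i))
  have hev : ∀ p, aeval x p = ev (Ideal.Quotient.mk _ p) := fun p => by
    have : aeval x = ev.comp (Ideal.Quotient.mkₐ ℂ (vanishingIdeal ℂ V)) := by
      ext i
      simp [x]
    rw [this]
    rfl
  refine ⟨⟨x, hV.mem_of_forall fun p hp => ?_⟩, ?_⟩
  · rw [hev, Ideal.Quotient.eq_zero_iff_mem.2 hp, map_zero]
  · ext b
    obtain ⟨p, rfl⟩ := Ideal.Quotient.mk_surjective b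
    exact hev p

/-- Restriction of polynomial functions to a subset. -/
noncomputable def restrict {n : ℕ} {V F : Set (Fin n → ℂ)} (h : F ⊆ V) :
    CoordinateRing V →+* CoordinateRing F :=
  Ideal.Quotient.factor fun _ hp => mem_vanishingIdeal_iff.2 fun x hx => hp x (h hx)

section Restrict

variable {n : ℕ} {V F : Set (Fin n → ℂ)} (h : F ⊆ V)

theorem restrict_surjective : Function.Surjective (restrict h) :=
  Ideal.Quotient.factor_surjective _

theorem evalAt_restrict (x : F) (b : CoordinateRing V) :
    evalAt F x (restrict h b) = evalAt V ⟨x, h x.2⟩ b := by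
  obtain ⟨p, rfl⟩ := Ideal.Quotient.mk_surjective b
  rfl

theorem restrict_eq_zero_iff (b : CoordinateRing V) :
    restrict h b = 0 ↔ ∀ x : F, evalAt V ⟨x, h x.2⟩ b = 0 := by
  obtain ⟨p, rfl⟩ := Ideal.Quotient.mk_surjective b
  rw [restrict, Ideal.Quotient.factor_mk, Ideal.Quotient.eq_zero_iff_mem, mem_vanishingIdeal_iff]
  exact ⟨fun hp x => hp x x.2, fun hp x hx => hp ⟨x, hx⟩⟩

end Restrict

/-- If `F` is, near `x`, the fiber of `t` through `x`, and this fiber is reduced, then the local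
ring of `F` at `x` is that of `V` modulo the equations `tᵢ = tᵢ(x)`. -/
theorem IsAffineVariety.nonempty_quotient_localShift_equiv {n d : ℕ} {V F : Set (Fin n → ℂ)}
    (hV : IsAffineVariety V) (h : F ⊆ V) (x : F) (t : Fin d → CoordinateRing V)
    (hrad : (Ideal.span (Set.range (shift (evalAt V ⟨x, h x.2⟩) t))).IsRadical)
    {e : CoordinateRing V} (he : evalAt V ⟨x, h x.2⟩ e ≠ 0)
    (htF : ∀ (x' : F) (j : Fin d), evalAt V ⟨x', h x'.2⟩ (t j) = evalAt V ⟨x, h x.2⟩ (t j))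
    (heF : ∀ x' : V, (∀ j, evalAt V x' (t j) = evalAt V ⟨x, h x.2⟩ (t j)) → evalAt V x' e ≠ 0 →
      (x' : Fin n → ℂ) ∈ F) :
    Nonempty ((LocalRingPt (evalAt V ⟨x, h x.2⟩) ⧸
      Ideal.span (Set.range (localShift (evalAt V ⟨x, h x.2⟩) t))) ≃+* LocalRingAt F x) := by
  let ev := evalAt V ⟨x, h x.2⟩
  have hcomap : ptIdeal ev = (pointIdeal F x).comap (restrict h) := by
    ext b
    rw [mem_ptIdeal, Ideal.mem_comap, pointIdeal, RingHom.mem_ker, evalAt_restrict]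
  let ψ : LocalRingPt ev →+* LocalRingAt F x :=
    Localization.localRingHom (ptIdeal ev) (pointIdeal F x) (restrict h) hcomap
  have hψ : ∀ b, ψ (algebraMap _ _ b) = algebraMap _ _ (restrict h b) :=
    Localization.localRingHom_to_map _ _ _ hcomap
  have hsurj : Function.Surjective ψ := by
    intro r
    obtain ⟨b, s, rfl⟩ := IsLocalization.exists_mk'_eq (pointIdeal F x).primeCompl r
    obtain ⟨b, rfl⟩ := restrict_surjective h b
    obtain ⟨s, hs⟩ := s
    obtain ⟨s, rfl⟩ := restrict_surjective h s
    have hs' : s ∈ (ptIdeal ev).primeCompl := fun hmem => hs (by rwa [hcomap] at hmem)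
    exact ⟨IsLocalization.mk' _ b ⟨s, hs'⟩, Localization.localRingHom_mk' _ _ _ hcomap b ⟨s, hs'⟩⟩
  have hker : RingHom.ker ψ = Ideal.span (Set.range (localShift ev t)) := by
    refine le_antisymm (fun r hr => ?_) (Ideal.span_le.2 ?_)
    · obtain ⟨b, s, rfl⟩ := IsLocalization.exists_mk'_eq (ptIdeal ev).primeCompl r
      rw [← map_span_shift, IsLocalization.mk'_mem_iff]
      have hb : algebraMap _ (LocalRingAt F x) (restrict h b) = 0 := by
        rw [← hψ, ← IsLocalization.mk'_spec (LocalRingPt ev) b s, map_mul, RingHom.mem_ker.1 hr,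
          zero_mul]
      obtain ⟨⟨c, hc⟩, hcb⟩ := (IsLocalization.map_eq_zero_iff (pointIdeal F x).primeCompl _ _).1 hb
      obtain ⟨c, rfl⟩ := restrict_surjective h c
      rw [← map_mul, restrict_eq_zero_iff] at hcb
      rw [IsLocalization.algebraMap_mem_map_algebraMap_iff (ptIdeal ev).primeCompl]
      have he' : e ∈ (ptIdeal ev).primeCompl := fun hmem => he (mem_ptIdeal.1 hmem)
      have hc' : c ∈ (ptIdeal ev).primeCompl := fun hmem => hc (by rwa [hcomap] at hmem)
      -- The product cb vanishes on F, and e vanishes on the rest of the fiber of t. So ecb vanishes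
      -- on the whole fiber of t, whose ideal is radical.
      refine ⟨e * c, mul_mem he' hc', hrad ?_⟩
      refine mem_radical_of_forall_pt (k := ℂ) fun ev' hle => ?_
      obtain ⟨x', rfl⟩ := hV.exists_evalAt_eq ev'
      have ht := (aeval_eq_of_span_shift_le hle).1
      rw [mul_assoc, map_mul]
      by_cases he' : evalAt V x' e = 0
      · rw [he', zero_mul]
      · rw [hcb ⟨x', heF x' ht he'⟩, mul_zero]
    · rintro _ ⟨j, rfl⟩
      refine RingHom.mem_ker.2 ?_
      rw [localShift, hψ, (restrict_eq_zero_iff h _).2 fun x' => ?_, map_zero]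
      simp [shift, htF x' j, ev]
  exact ⟨(Ideal.quotEquivOfEq hker.symm).trans (RingHom.quotientKerEquivOfSurjective hsurj)⟩

/-- Functions `bᵢ` that are integral over the functions `tⱼ` take finitely many values on a fiber
of `t`; some function on the source separates the fibers of `b` contained in it. -/
theorem exists_separating {k B : Type*} [Field k] [CommRing B] [Algebra k B] {d m : ℕ}
    {t : Fin d → B} {b : Fin m → B}
    (hb : ∀ i, (aeval t : MvPolynomial (Fin d) k →ₐ[k] B).toRingHom.IsIntegralElem (b i))
    (ev : B →ₐ[k] k) :
    ∃ e : B, ev e ≠ 0 ∧ ∀ ev' : B →ₐ[k] k, (∀ j, ev' (t j) = ev (t j)) → ev' e ≠ 0 →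
      ∀ i, ev' (b i) = ev (b i) := by
  choose H hmonic hH using hb
  let h : Fin m → Polynomial k := fun i => (H i).map (aeval fun j => ev (t j)).toRingHom
  have hh : ∀ i, h i ≠ 0 := fun i => ((hmonic i).map _).ne_zero
  -- hᵢ is the integral equation of bᵢ with coefficients evaluated at t(x), so it is constant along
  -- the fiber of t. Removing the full power of the root bᵢ(x) leaves Eᵢ, nonzero at that root and
  -- zero at every other root.
  choose E hE hEne using fun i =>
    Polynomial.exists_eq_pow_rootMultiplicity_mul_and_not_dvd (h i) (hh i) (ev (b i))
  have hev : ∀ (ev' : B →ₐ[k] k) i, ev' (Polynomial.aeval (b i) (E i)) = (E i).eval (ev' (b i)) := by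
    intro ev' i
    rw [← Polynomial.aeval_algHom_apply, Polynomial.coe_aeval_eq_eval]
  refine ⟨∏ i, Polynomial.aeval (b i) (E i), ?_, fun ev' ht hne i => ?_⟩
  · rw [map_prod, Finset.prod_ne_zero_iff]
    intro i _ h0
    rw [hev] at h0
    exact hEne i (Polynomial.dvd_iff_isRoot.2 h0)
  · rw [map_prod, Finset.prod_ne_zero_iff] at hne
    have hne := hne i (Finset.mem_univ i)
    rw [hev] at hne
    have h0 : (h i).eval (ev' (b i)) = 0 := by
      have := congrArg ev'.toRingHom (hH i)
      rw [map_zero, Polynomial.hom_eval₂] at this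
      rw [← this, Polynomial.eval_map]
      congr 1
      refine RingHom.ext fun p => ?_
      change aeval (fun j => ev (t j)) p = ev' (aeval t p)
      rw [← AlgHom.comp_apply ev' (aeval t), comp_aeval]
      simp only [ht]
    rw [hE i, Polynomial.eval_mul, Polynomial.eval_pow] at h0
    by_contra hi
    refine pow_ne_zero _ ?_ ((mul_eq_zero.1 h0).resolve_right hne)
    simpa [sub_eq_zero] using hi

end SingularFibers

/-! ### Reduction of a polynomial map to a map to affine space. -/

namespace SingularFibers

open MvPolynomial

/-- Generic smoothness of the fibers of a polynomial map: over an open subset of the target, the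
local ring of the reduced fiber at `x` is regular if and only if that of the source is. -/
theorem exists_forall_isRegularLocalRing_fiber_iff {n m : ℕ} {V : Set (Fin n → ℂ)}
    (hV : IsAffineVariety V) [IsDomain (CoordinateRing V)] {f : (Fin n → ℂ) → (Fin m → ℂ)}
    {P : Fin m → MvPolynomial (Fin n) ℂ} (hf : ∀ x ∈ V, ∀ i, f x i = eval x (P i)) :
    ∃ G : MvPolynomial (Fin m) ℂ, (∃ x ∈ V, aeval (f x) G ≠ 0) ∧
      ∀ (y : Fin m → ℂ), aeval y G ≠ 0 → ∀ x : fiber f V y,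
        (IsRegularLocalRing (LocalRingAt (fiber f V y) x) ↔
          IsRegularLocalRing (LocalRingAt V ⟨x, x.2.1⟩)) := by
  let b : Fin m → CoordinateRing V := fun i => Ideal.Quotient.mk _ (P i)
  let φ : MvPolynomial (Fin m) ℂ →ₐ[ℂ] CoordinateRing V := aeval b
  have hb : ∀ (x : V) i, evalAt V x (b i) = f x i := fun x i => (hf x x.2 i).symm
  have hφ : ∀ (x : V) p, evalAt V x (φ p) = aeval (f x) p := fun x p => by
    rw [← AlgHom.comp_apply, comp_aeval]
    simp only [hb]
  have : Algebra.FiniteType ℂ φ.range := .of_surjective φ.rangeRestrict φ.rangeRestrict_surjective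
  -- Noether normalization of the image algebra: the tⱼ are algebraically independent and every
  -- component of f is integral over them.
  obtain ⟨d, ν, hinj, hfin⟩ := exists_finite_inj_algHom_of_fg ℂ φ.range
  let t : Fin d → CoordinateRing V := fun j => (ν (X j) : CoordinateRing V)
  have ht : (aeval t : MvPolynomial (Fin d) ℂ →ₐ[ℂ] _) = φ.range.val.comp ν := by
    ext j
    simp [t]
  have htind : AlgebraicIndependent ℂ t := by
    rw [AlgebraicIndependent, ht]
    exact Subtype.val_injective.comp hinj
  have hint : ∀ i, (aeval t : MvPolynomial (Fin d) ℂ →ₐ[ℂ] _).toRingHom.IsIntegralElem (b i) := by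
    intro i
    obtain ⟨H, hmonic, hH⟩ := hfin.to_isIntegral ⟨b i, X i, aeval_X b i⟩
    refine ⟨H, hmonic, ?_⟩
    have := congrArg φ.range.val.toRingHom hH
    rw [map_zero, Polynomial.hom_eval₂] at this
    rw [ht]
    exact this
  -- Each tⱼ is the pullback of a polynomial qⱼ on the target. So t is constant on the fibers of f,
  -- and g(t) ≠ 0 is the condition g(q) ≠ 0 on y.
  choose q hq using fun j => (ν (X j)).2
  obtain ⟨g, hg, hgood⟩ := exists_forall_isRegularLocalRing_iff (k := ℂ) htind
  have hφg : φ (aeval q g) = aeval t g := by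
    rw [← AlgHom.comp_apply, comp_aeval]
    congr 2
    exact funext hq
  have ht0 : ∀ x : V, ∀ j, evalAt V x (t j) = aeval (f x) (q j) := fun x j => by
    rw [← hφ]; exact congrArg _ (hq j).symm
  refine ⟨aeval q g, ?_, fun y hy x => ?_⟩
  · by_contra! hcon
    have h0 : aeval t g = 0 := by
      rw [← hφg]
      obtain ⟨p, hp⟩ := Ideal.Quotient.mk_surjective (φ (aeval q g))
      rw [← hp, Ideal.Quotient.eq_zero_iff_mem, mem_vanishingIdeal_iff]
      intro x hx
      rw [← evalAt_mk V ⟨x, hx⟩, hp, hφ]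
      exact hcon x hx
    exact hg (htind (by rw [h0, map_zero]))
  · have hxy : f x = y := x.2.2
    have hev : evalAt V ⟨x, x.2.1⟩ (aeval t g) ≠ 0 := by
      rw [← hφg, hφ]
      simpa only [hxy] using hy
    obtain ⟨hiff, hrad⟩ := hgood _ hev
    obtain ⟨e, he, hsep⟩ := exists_separating hint (evalAt V ⟨x, x.2.1⟩)
    have hsub : fiber f V y ⊆ V := fun _ h => h.1
    obtain ⟨E⟩ := hV.nonempty_quotient_localShift_equiv hsub x t hrad he
      (fun x' j => by
        have hx'y : f x' = y := x'.2.2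
        rw [ht0, ht0]
        simp only [hxy, hx'y])
      (fun x' h1 h2 => ⟨x'.2, by
        rw [← hxy]
        funext i
        have := hsep _ h1 h2 i
        rwa [hb, hb] at this⟩)
    have key : IsRegularLocalRing (LocalRingAt (fiber f V y) x) ↔
        IsRegularLocalRing (LocalRingPt (evalAt V ⟨x, x.2.1⟩) ⧸
          Ideal.span (Set.range (localShift (evalAt V ⟨x, x.2.1⟩) t))) :=
      ⟨fun _ => IsRegularLocalRing.of_ringEquiv (R := LocalRingAt (fiber f V y) x) E.symm,
        fun _ => IsRegularLocalRing.of_ringEquiv E⟩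
    exact key.trans hiff

end SingularFibers

/-! ### The theorem. -/

open SingularFibers MvPolynomial in
theorem mainTheorem1 {n m : ℕ} (X : Set (Fin n → ℂ)) (Y : Set (Fin m → ℂ))
    (hX : SingularFibers.IsAffineVariety X) (hXirr : SingularFibers.IsZariskiIrreducible X)
    (hY : SingularFibers.IsAffineVariety Y)
    (f : (Fin n → ℂ) → (Fin m → ℂ)) (hf : SingularFibers.IsPolynomialMapOn f X)
    (hfXY : Set.MapsTo f X Y) (hdom : SingularFibers.IsZariskiDenseIn (f '' X) Y) :
    SingularFibers.ForGeneric Y fun y =>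
      SingularFibers.Sing (SingularFibers.fiber f X y) =
        SingularFibers.fiber f X y ∩ SingularFibers.Sing X := by
  have := hXirr.isDomain_coordinateRing
  obtain ⟨P, hP⟩ := hf
  obtain ⟨G, ⟨x₀, hx₀, hG⟩, hgood⟩ := exists_forall_isRegularLocalRing_fiber_iff hX hP
  let b : Fin m → CoordinateRing X := fun i => Ideal.Quotient.mk _ (P i)
  have heval : ∀ (x : X) p, evalAt X x (aeval b p) = aeval (f x) p := fun x p => by
    rw [← AlgHom.comp_apply, comp_aeval]
    congr 2
    exact funext fun i => (hP x x.2 i).symm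
  have hzero : ∀ c : CoordinateRing X, (∀ x, evalAt X x c = 0) → c = 0 := fun c hc => by
    obtain ⟨p, rfl⟩ := Ideal.Quotient.mk_surjective c
    exact Ideal.Quotient.eq_zero_iff_mem.2 (mem_vanishingIdeal_iff.2 fun x hx => hc ⟨x, hx⟩)
  refine ⟨Y ∩ {y | aeval y G ≠ 0}, ⟨{y | aeval y G ≠ 0}, ?_, rfl⟩,
    ⟨Set.inter_subset_left, ?_⟩, ?_⟩
  · rw [← @isClosed_compl_iff _ (zariski m)]
    refine isAffineVariety_iff.2 ⟨Ideal.span {G}, ?_⟩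
    ext y
    rw [zeroLocus_span]
    simp
  · rw [subset_zariski_closure_iff]
    intro p hp
    -- Density of U: if p vanishes on U, then (p ∘ f)(G ∘ f) = 0 on X. The coordinate ring is a
    -- domain and G ∘ f ≠ 0, so p ∘ f = 0, and dominance gives p = 0 on Y.
    have hmul : aeval b p * aeval b G = 0 := by
      refine hzero _ fun x => ?_
      rw [map_mul, heval, heval]
      by_cases h0 : aeval (f x) G = 0
      · rw [h0, mul_zero]
      · rw [mem_vanishingIdeal_iff.1 hp (f x) ⟨hfXY x.2, h0⟩, zero_mul]
    have hG0 : aeval b G ≠ 0 := fun h0 => hG (by rw [← heval ⟨x₀, hx₀⟩, h0, map_zero])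
    have hp0 := (mul_eq_zero.1 hmul).resolve_right hG0
    refine (subset_zariski_closure_iff.1 hdom.2) (mem_vanishingIdeal_iff.2 ?_)
    rintro _ ⟨x, hx, rfl⟩
    rw [← heval ⟨x, hx⟩, hp0, map_zero]
  · rintro y ⟨-, hy⟩
    ext x
    constructor
    · rintro ⟨hx, hsing⟩
      exact ⟨hx, hx.1, fun h => hsing ((hgood y hy ⟨x, hx⟩).2 h)⟩
    · rintro ⟨hx, _, hsing⟩
      exact ⟨hx, fun h => hsing ((hgood y hy ⟨x, hx⟩).1 h)⟩
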